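/- **Setting.** Let $A\subset\mathbb R^m$ be a finite set of actions, $\mathcal X$ a finite state space, $\Omega=\mathcal X^{\mathbb N_0}$ with the product $\sigma$-algebra and canonical process $(X_t)_{t\ge 0}$, $r:\mathcal X\times A\times\mathcal X\to\mathbb R$ a reward function, $0<\alpha<1$, $\varepsilon>0$, and $q\ge 1$ an integer. Write $\mathcal M_1$ for sets of probability measures. A policy is a sequence $\mathbf a=(a_t)_{t\ge0}$ of maps $a_t:\mathcal X\to A$. Let $\widehat{\mathbb P}:\mathcal X\times A\to\mathcal M_1(\mathcal X)$ be a reference kernel and let $\widehat{\mathbb P}_{x_0,\mathbf a}=\delta_{x_0}\otimes\widehat{\mathbb P}(\cdot,a_0(\cdot))\otimes\widehat{\mathbb P}(\cdot,a_1(\cdot))\otimes\cdots$ on $\Omega$. For probability measures on a finite subset of a Euclidean space let $W_q(\mu,\nu)=\big(\inf_{\pi}\int\|x-y\|^q\,d\pi(x,y)\big)^{1/q}$, the infimum being over all couplings $\pi$ of $\mu$ and $\nu$. For an ambiguity map $(x,a)\mapsto\mathcal P(x,a)\subseteq\mathcal M_1(\mathcal X)$ let $\mathfrak P_{x,\mathbf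 a}$ be the set of all $\delta_x\otimes\mathbb P_0\otimes\mathbb P_1\otimes\cdots$ with kernels satisfying $\mathbb P_t(y)\in\mathcal P(y,a_t(y))$ for all $t,y$, and define $$V(x)=\sup_{\mathbf a}\inf_{\mathbb P\in\mathfrak P_{x,\mathbf a}}\mathbb E_{\mathbb P}\Big[\sum_{t=0}^\infty\alpha^t r(X_t,a_t(X_t),X_{t+1})\Big],\qquad Q^*(x,a)=\inf_{\mathbb P\in\mathcal P(x,a)}\int_{\mathcal X}\big(r(x,a,y)+\alpha V(y)\big)\,\mathbb P(dy).$$ **Algorithm.** For $c:\mathcal X\times\mathcal X\to[0,\infty]$, $\lambda\ge0$ and $g:\mathcal X\to\mathbb R$ let $g^{\lambda c}(x)=\sup\{g(y)-\lambda c(x,y): y\in\mathcal X,\ c(x,y)<\infty\}$. Fix $x_0\in\mathcal X$, a policy $\mathbf a$, learning rates $(\widetilde\gamma_n)_{n\ge0}\subseteq[0,1]$ and an arbitrary $Q_0:\mathcal X\times A\to\mathbb R$. Let $\mathrm{visits}_t(x,a)=\#\{s\le t:(X_s,a_s(X_s))=(x,a)\}$, let $\gamma_t(x,a,X_t)=\widetilde\gamma_{\mathrm{visits}_t(x,a)}$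 if $(x,a)=(X_t,a_t(X_t))$ and $\gamma_t(x,a,X_t)=0$ otherwise, and let $f_{t,(x,a)}(y)=r(x,a,y)+\alpha\max_{b\in A}Q_t(y,b)$. At each time $t$ a number $\lambda_t\ge0$, depending only on $X_0,\dots,X_t$, is chosen that maximizes $$\lambda\mapsto\int_{\mathcal X}\Big(-(-f_{t,(X_t,a_t(X_t))})^{\lambda c}(y)-\varepsilon^q\lambda\Big)\,\widehat{\mathbb P}(X_t,a_t(X_t))(dy)$$ over $[0,\infty)$, and for all $(x,a)$ $$Q_{t+1}(x,a)=Q_t(x,a)+\gamma_t(x,a,X_t)\Big(-(-f_{t,(x,a)})^{\lambda_tc}(X_{t+1})-\varepsilon^q\lambda_t-Q_t(x,a)\Big).$$ **Theorem.** Assume that, $\widehat{\mathbb P}_{x_0,\mathbf a}$-almost surely, $\sum_{t=1}^\infty\gamma_t(x,a,X_t)=\infty$ and $\sum_{t=1}^\infty\gamma_t(x,a,X_t)^2<\infty$ for all $(x,a)\in\mathcal X\times A$. (i) Let $\mathcal X\subset\mathbb R^d$ be finite, $\mathcal P(x,a)=\{\mathbb P\in\mathcal M_1(\mathcal X): W_q(\mathbb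 P,\widehat{\mathbb P}(x,a))\le\varepsilon\}$, and run the algorithm with $c(x,y)=\|x-y\|^q$. Then for all $(x,a)\in\mathcal X\times A$, $\lim_{t\to\infty}Q_t(x,a)=Q^*(x,a)$ $\widehat{\mathbb P}_{x_0,\mathbf a}$-almost surely. (ii) Let $\mathcal X=T^h$ with $h\ge2$ and $T\subset\mathbb R^D$ finite, and write $\pi(x)=(x_2,\dots,x_h)$. Let $\widehat{\mathbb P}(x,a)=\delta_{\pi(x)}\otimes\widetilde{\mathbb P}_{x,a}$ with $\widetilde{\mathbb P}_{x,a}\in\mathcal M_1(T)$, let $\mathcal P(x,a)=\{\delta_{\pi(x)}\otimes\mu:\mu\in\mathcal M_1(T),\ W_q(\mu,\widetilde{\mathbb P}_{x,a})\le\varepsilon\}$, and run the algorithm with $c(x,y)=\|x_h-y_h\|^q$ if $(x_1,\dots,x_{h-1})=(y_1,\dots,y_{h-1})$ and $c(x,y)=\infty$ otherwise. Then for all $(x,a)\in\mathcal X\times A$, $\lim_{t\to\infty}Q_t(x,a)=Q^*(x,a)$ $\widehat{\mathbb P}_{x_0,\mathbf a}$-almost surely. -/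

import Mathlib

open MeasureTheory ProbabilityTheory Filter Topology
open scoped ENNReal NNReal

noncomputable section

namespace RobustQ

section PathMeasure

variable {S : Type*} [MeasurableSpace S] [Countable S] [MeasurableSingletonClass S]

/-- The transition kernel at time `n` of the path measure: the next state is drawn from `p n y`
where `y` is the current state (the last entry of the history). -/
def historyKernel (p : ℕ → S → ProbabilityMeasure S) (n : ℕ) :
    Kernel ((i : Finset.Iic n) → (fun _ : ℕ => S) i) S :=
  (Kernel.ofFunOfCountable (fun y : S => (p n y : Measure S))).comap
    (fun h => h ⟨n, Finset.mem_Iic.2 le_rfl⟩) (measurable_pi_apply _)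

instance (p : ℕ → S → ProbabilityMeasure S) (n : ℕ) : IsMarkovKernel (historyKernel p n) := by
  have : IsMarkovKernel (Kernel.ofFunOfCountable (fun y : S => (p n y : Measure S))) :=
    ⟨fun y => (p n y).2⟩
  unfold historyKernel
  infer_instance

/-- The law `δ_x ⊗ p₀ ⊗ p₁ ⊗ ⋯` on the path space `Ω = S^ℕ` (with the product σ-algebra). The
canonical process is `X_t ω = ω t`. -/
def pathMeasure (x : S) (p : ℕ → S → ProbabilityMeasure S) : ProbabilityMeasure (ℕ → S) :=
  ⟨Kernel.trajMeasure (X := fun _ => S) (Measure.dirac x) (historyKernel p), inferInstance⟩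

end PathMeasure

section Transport

variable {S : Type*} [MeasurableSpace S]

/-- The joint distributions on `S × S` with marginals `μ` and `ν`. -/
def couplings (μ ν : ProbabilityMeasure S) : Set (ProbabilityMeasure (S × S)) :=
  {π | (π : Measure (S × S)).map Prod.fst = μ ∧ (π : Measure (S × S)).map Prod.snd = ν}

/-- The cost `(x, y) ↦ ‖x - y‖ ^ q` on a finite subset of a normed space. -/
def normCost {E : Type*} [NormedAddCommGroup E] {X : Finset E} (q : ℕ) (x y : X) : ℝ≥0∞ :=
  ENNReal.ofReal (‖(x : E) - (y : E)‖ ^ q)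

/-- The `q`-Wasserstein distance of two probability measures on a finite subset of a normed
space. -/
def wasserstein {E : Type*} [NormedAddCommGroup E] {X : Finset E} [MeasurableSpace X] (q : ℕ)
    (μ ν : ProbabilityMeasure X) : ℝ≥0∞ :=
  (⨅ π ∈ couplings μ ν, ∫⁻ z, normCost q z.1 z.2 ∂(π : Measure (X × X))) ^ (1 / (q : ℝ))

/-- The Wasserstein ball of radius `ε` around `μ₀`. -/
def wassersteinBall {E : Type*} [NormedAddCommGroup E] {X : Finset E} [MeasurableSpace X] (q : ℕ)
    (ε : ℝ) (μ₀ : ProbabilityMeasure X) : Set (ProbabilityMeasure X) :=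
  {μ | wasserstein q μ μ₀ ≤ ENNReal.ofReal ε}

end Transport

section TimeSeries

/-- The measure `δ_z ⊗ μ` on `T^(k+1) = T^k × T`. -/
def carryOver {T : Type*} [MeasurableSpace T] [Countable T] [MeasurableSingletonClass T] {k : ℕ}
    (z : Fin k → T) (μ : ProbabilityMeasure T) : ProbabilityMeasure (Fin (k + 1) → T) :=
  ⟨((Measure.dirac z).prod (μ : Measure T)).map
      (fun w : (Fin k → T) × T => (Fin.snoc w.1 w.2 : Fin (k + 1) → T)),
    Measure.isProbabilityMeasure_map (measurable_from_prod_countable_right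
      (fun _ => Measurable.of_discrete)).aemeasurable⟩

/-- The time-series ambiguity set at the state `x = (x₁, …, x_h)`: all measures `δ_{π(x)} ⊗ μ`
with `π(x) = (x₂, …, x_h)` and `μ` in the Wasserstein ball around `μ₀`. -/
def timeSeriesBall {E : Type*} [NormedAddCommGroup E] {T : Finset E} [MeasurableSpace T]
    [MeasurableSingletonClass T] {k : ℕ} (q : ℕ) (ε : ℝ) (x : Fin (k + 1) → T)
    (μ₀ : ProbabilityMeasure T) : Set (ProbabilityMeasure (Fin (k + 1) → T)) :=
  {P | ∃ μ ∈ wassersteinBall q ε μ₀, P = carryOver (Fin.tail x) μ}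

open Classical in
/-- The cost on `T^(k+1)` which is infinite if the first `k` components differ, and is otherwise
`‖x_h - y_h‖ ^ q` for the last components. -/
def timeSeriesCost {E : Type*} [NormedAddCommGroup E] {T : Finset E} {k : ℕ} (q : ℕ)
    (x y : Fin (k + 1) → T) : ℝ≥0∞ :=
  (if Fin.init x ≠ Fin.init y then ∞ else 0) + normCost q (x (Fin.last k)) (y (Fin.last k))

end TimeSeries

section ControlProblem

variable {S A : Type*} [MeasurableSpace S] [Countable S] [MeasurableSingletonClass S]

/-- The law of the state process started in `x` under the policy `a` (a sequence of maps from
states to actions) if the next state has law `Phat y b` given state `y` and action `b`. -/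
def controlledMeasure (Phat : S → A → ProbabilityMeasure S) (x : S) (a : ℕ → S → A) :
    ProbabilityMeasure (ℕ → S) :=
  pathMeasure x (fun t y => Phat y (a t y))

/-- The admissible path measures `δ_x ⊗ p₀ ⊗ p₁ ⊗ ⋯` with `p_t y ∈ P(y, a_t y)`. -/
def admissibleMeasures (P : S → A → Set (ProbabilityMeasure S)) (x : S) (a : ℕ → S → A) :
    Set (ProbabilityMeasure (ℕ → S)) :=
  {μ | ∃ p : ℕ → S → ProbabilityMeasure S,
    (∀ t y, p t y ∈ P y (a t y)) ∧ μ = pathMeasure x p}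

/-- The value function of the robust control problem: the supremum over policies of the infimum
over admissible measures of the expected discounted total reward. -/
def robustValue (α : ℝ) (r : S → A → S → ℝ) (P : S → A → Set (ProbabilityMeasure S)) (x : S) : ℝ :=
  ⨆ a : ℕ → S → A, ⨅ μ : admissibleMeasures P x a,
    ∫ ω, ∑' t : ℕ, α ^ t * r (ω t) (a t (ω t)) (ω (t + 1)) ∂(μ.1 : Measure (ℕ → S))

/-- The optimal robust `Q`-value function `Q*`. -/
def optimalQ (α : ℝ) (r : S → A → S → ℝ) (P : S → A → Set (ProbabilityMeasure S))
    (x : S) (b : A) : ℝ :=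
  ⨅ μ : P x b, ∫ y, (r x b y + α * robustValue α r P y) ∂(μ.1 : Measure S)

end ControlProblem

section Algorithm

variable {S A : Type*}

/-- The `λc`-transform `x ↦ sup_y {g y - λ c(x, y)}` of `g`. Points `y` with `c(x, y) = ∞` never
contribute, also for `λ = 0` (that is, `λ · ∞ = ∞` for all `λ ≥ 0`). -/
def lambdaCTransform (c : S → S → ℝ≥0∞) (l : ℝ) (g : S → ℝ) (x : S) : ℝ :=
  ⨆ y : {y : S // c x y ≠ ∞}, (g y - l * (c x y).toReal)

/-- The function `f_{(x,b)}(y) = r(x, b, y) + α max_{b'} Q(y, b')`. -/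
def target (α : ℝ) (r : S → A → S → ℝ) (Q : S → A → ℝ) (x : S) (b : A) (y : S) : ℝ :=
  r x b y + α * ⨆ b' : A, Q y b'

/-- The quantity `-(-f_{(x,b)})^{λc}(y) - ε ^ q λ`. -/
def sampleTarget (α ε : ℝ) (q : ℕ) (r : S → A → S → ℝ) (c : S → S → ℝ≥0∞) (Q : S → A → ℝ)
    (x : S) (b : A) (l : ℝ) (y : S) : ℝ :=
  -lambdaCTransform c l (fun z => -target α r Q x b z) y - ε ^ q * l

open Classical in
/-- The number of visits of the pair `(x, b)` at the times `0, …, t` along the path `ω`. -/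
def visits (a : ℕ → S → A) (t : ℕ) (ω : ℕ → S) (x : S) (b : A) : ℕ :=
  ((Finset.range (t + 1)).filter (fun s => (ω s, a s (ω s)) = (x, b))).card

open Classical in
/-- The learning rate `γ_t(x, b, X_t)` along the path `ω`. -/
def learningRate (γ : ℕ → ℝ) (a : ℕ → S → A) (t : ℕ) (ω : ℕ → S) (x : S) (b : A) : ℝ :=
  if (ω t, a t (ω t)) = (x, b) then γ (visits a t ω x b) else 0

/-- The iterates `Q_t` of robust `Q`-learning along the path `ω`, started in `Q₀`, where `lam t ω`
is the multiplier used at time `t`. -/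
def qIterate (α ε : ℝ) (q : ℕ) (r : S → A → S → ℝ) (c : S → S → ℝ≥0∞) (γ : ℕ → ℝ)
    (a : ℕ → S → A) (Q₀ : S → A → ℝ) (lam : ℕ → (ℕ → S) → ℝ) : ℕ → (ℕ → S) → S → A → ℝ
  | 0, _, x, b => Q₀ x b
  | t + 1, ω, x, b =>
    let Q := qIterate α ε q r c γ a Q₀ lam t ω
    Q x b + learningRate γ a t ω x b *
      (sampleTarget α ε q r c Q x b (lam t ω) (ω (t + 1)) - Q x b)

variable [MeasurableSpace S]

/-- Admissible choices of the multipliers `λ_t`: at each time `t` it is chosen on the basis of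
`X_0, …, X_t`, it is nonnegative, and it maximizes
`λ ↦ E[-(-f)^{λc}(X_{t+1}) - ε ^ q λ]` over `λ ≥ 0`, where `f = f_{t,(X_t, a_t(X_t))}` is
built from the current iterate and `X_{t+1}` has law `Phat(X_t, a_t(X_t))`. -/
def IsMultiplierChoice (α ε : ℝ) (q : ℕ) (r : S → A → S → ℝ) (c : S → S → ℝ≥0∞)
    (Phat : S → A → ProbabilityMeasure S) (γ : ℕ → ℝ) (a : ℕ → S → A) (Q₀ : S → A → ℝ)
    (lam : ℕ → (ℕ → S) → ℝ) : Prop :=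
  Adapted (Filtration.piLE (X := fun _ : ℕ => S)) lam ∧
  ∀ t ω, 0 ≤ lam t ω ∧
    IsMaxOn (fun l : ℝ => ∫ y, sampleTarget α ε q r c (qIterate α ε q r c γ a Q₀ lam t ω)
        (ω t) (a t (ω t)) l y ∂(Phat (ω t) (a t (ω t)) : Measure S))
      (Set.Ici 0) (lam t ω)

/-- The step-size condition: almost surely, for all pairs `(x, b)`, the learning rates along the
trajectory sum to infinity and their squares are summable. -/
def StepSizeCondition (μ : ProbabilityMeasure (ℕ → S)) (γ : ℕ → ℝ) (a : ℕ → S → A) : Prop :=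
  ∀ x b, ∀ᵐ ω ∂(μ : Measure (ℕ → S)),
    Tendsto (fun n => ∑ t ∈ Finset.Icc 1 n, learningRate γ a t ω x b) atTop atTop ∧
    Summable (fun t => learningRate γ a (t + 1) ω x b ^ 2)

end Algorithm

end RobustQ

end

/-!
Robust `Q`-learning is a stochastic approximation scheme for the fixed point of a contraction; the
argument combines four ingredients.

*Duality.* On a finite space the dual function `l ↦ ∫ (-(-f)^{lc}) dν - ε ^ q l` is a minimum of
finitely many affine functions of `l`, one for each transport map. At a maximizer, a mixture of two
transport maps respects the transport budget and attains the dual value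
(`exists_convexCombination_of_isMaxOn`), so the dual value is the infimum of `∫ f dμ` over the
Wasserstein ball (`integral_lambdaCTransform_eq_infExp_wassersteinBall`). The time-series ambiguity
set is the image of a Wasserstein ball on `T`, which reduces it to the same duality.

*Dynamic programming.* The robust Bellman operator is a contraction, and the robust value function
is its fixed point: a greedy stationary policy attains it, and against any policy nearly worst-case
kernels prevent a larger value (`robustValue_eq_of_isFixedPt`). Hence `Q*` is the fixed point of the
`α`-contraction `Q ↦ inf_{μ ∈ P(x, b)} ∫ (r + α max Q) dμ` (`optimalQ_eq_infExp`), and by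
duality the sample used in one step of the algorithm has exactly this conditional mean.

*Noise.* An optimal multiplier satisfies `ε ^ q l ≤ 2 sup |f|`, so the noise at time `t` is bounded
by a constant times `B t`, the running maximum of the errors. After division by `B t`, the noise
weighted by the learning rates consists of martingale increments with almost surely summable squared
bounds, so its partial sums converge almost surely (`ae_tendsto_sum_increments`).

*Deterministic analysis.* On each such path the error follows a recursion with `α`-contracting
drift. Summation by parts bounds the accumulated noise from a late time on by a small multiple of
the running maximum, which forces the running maximum to stay bounded
(`IsContractiveRecursion.exists_bound`). The accumulated noise is then eventually small, and the
divergence of the learning rates turns an eventual bound `D` on the error into `α * D + η` for every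
`η > 0`; iterating, the error tends to zero (`IsContractiveRecursion.tendsto_norm_zero`).
-/

namespace RobustQ

/-! ### Functions of finitely many coordinates and the Markov property of path measures -/

section Path

variable {S : Type*}

theorem exists_eq_comp_frestrictLe {β : Type*} [Nonempty β] {t : ℕ} {f : (ℕ → S) → β}
    (hf : DependsOn f (Set.Iic t)) :
    ∃ g : ((i : Finset.Iic t) → (fun _ : ℕ => S) i) → β,
      f = g ∘ Preorder.frestrictLe (π := fun _ : ℕ => S) t := by
  have h : Function.FactorsThrough f (Preorder.frestrictLe (π := fun _ : ℕ => S) t) := by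
    intro ω ω' h
    refine hf fun i hi => ?_
    exact congrFun h ⟨i, Finset.mem_Iic.2 hi⟩
  exact ⟨Function.extend _ f (fun _ => Classical.arbitrary β), (h.extend_comp _).symm⟩

theorem dependsOn_eval {β : Type*} {t s : ℕ} (hs : s ≤ t) (f : S → β) :
    DependsOn (fun ω : ℕ → S => f (ω s)) (Set.Iic t) :=
  fun _ _ h => congrArg f (h s hs)

variable [Fintype S]

theorem exists_bound_of_dependsOn {t : ℕ} {f : (ℕ → S) → ℝ} (hf : DependsOn f (Set.Iic t)) :
    ∃ C, ∀ ω, ‖f ω‖ ≤ C := by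
  obtain ⟨g, rfl⟩ := exists_eq_comp_frestrictLe hf
  obtain ⟨C, hC⟩ := (Set.finite_range fun h => ‖g h‖).bddAbove
  exact ⟨C, fun ω => hC ⟨_, rfl⟩⟩

variable [MeasurableSpace S] [MeasurableSingletonClass S]

theorem measurable_piLE_of_dependsOn {β : Type*} [MeasurableSpace β] {t : ℕ} {f : (ℕ → S) → β}
    (hf : DependsOn f (Set.Iic t)) :
    Measurable[Filtration.piLE (X := fun _ : ℕ => S) t] f := by
  rcases isEmpty_or_nonempty β with h | h
  · have : IsEmpty (ℕ → S) := ⟨fun ω => h.elim (f ω)⟩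
    exact fun s _ => by convert MeasurableSet.empty; exact Subsingleton.elim _ _
  obtain ⟨g, rfl⟩ := exists_eq_comp_frestrictLe hf
  rw [Filtration.piLE_eq_comap_frestrictLe]
  exact Measurable.of_discrete.comp (comap_measurable _)

theorem measurable_of_dependsOn {β : Type*} [MeasurableSpace β] {t : ℕ} {f : (ℕ → S) → β}
    (hf : DependsOn f (Set.Iic t)) : Measurable f :=
  (measurable_piLE_of_dependsOn hf).mono (Filtration.piLE.le t) le_rfl

theorem integrable_of_dependsOn {μ : Measure (ℕ → S)} [IsFiniteMeasure μ] {t : ℕ}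
    {f : (ℕ → S) → ℝ} (hf : DependsOn f (Set.Iic t)) : Integrable f μ := by
  obtain ⟨C, hC⟩ := exists_bound_of_dependsOn hf
  exact Integrable.of_bound (measurable_of_dependsOn hf).aestronglyMeasurable C (.of_forall hC)

/-- Under a path measure, given the states up to time `t`, the next state has law `p t (ω t)`. -/
theorem integral_pathMeasure_succ (x : S) (p : ℕ → S → ProbabilityMeasure S) (t : ℕ)
    (g : (ℕ → S) → S → ℝ) (hg : ∀ y, DependsOn (fun ω => g ω y) (Set.Iic t)) :
    ∫ ω, g ω (ω (t + 1)) ∂(pathMeasure x p : Measure (ℕ → S)) =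
      ∫ ω, ∫ y, g ω y ∂(p t (ω t) : Measure S) ∂(pathMeasure x p : Measure (ℕ → S)) := by
  have hg' : DependsOn g (Set.Iic t) := fun ω ω' h => funext fun y => hg y h
  obtain ⟨k, rfl⟩ := exists_eq_comp_frestrictLe hg'
  have key := Kernel.map_frestrictLe_trajMeasure_compProd_eq_map_trajMeasure
    (X := fun _ : ℕ => S) (μ₀ := Measure.dirac x) (κ := historyKernel p) (a := t)
  have hm : Measurable (fun z : ((i : Finset.Iic t) → (fun _ : ℕ => S) i) × S => k z.1 z.2) :=
    Measurable.of_discrete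
  have hbd : ∃ C, ∀ z : ((i : Finset.Iic t) → (fun _ : ℕ => S) i) × S, ‖k z.1 z.2‖ ≤ C := by
    obtain ⟨C, hC⟩ := (Set.finite_range
      fun z : ((i : Finset.Iic t) → (fun _ : ℕ => S) i) × S => ‖k z.1 z.2‖).bddAbove
    exact ⟨C, fun ω => hC ⟨_, rfl⟩⟩
  obtain ⟨C, hC⟩ := hbd
  have h1 := congrArg (fun μ => ∫ z, k z.1 z.2 ∂μ) key
  rw [integral_map (by fun_prop) hm.aestronglyMeasurable, Measure.integral_compProd
    (Integrable.of_bound hm.aestronglyMeasurable C (.of_forall hC)),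
    integral_map (by fun_prop) Measurable.of_discrete.aestronglyMeasurable] at h1
  exact h1.symm

theorem ae_pathMeasure_zero (x : S) (p : ℕ → S → ProbabilityMeasure S) :
    ∀ᵐ ω ∂(pathMeasure x p : Measure (ℕ → S)), ω 0 = x := by
  have h : (pathMeasure x p : Measure (ℕ → S)) = Kernel.traj (X := fun _ => S) (historyKernel p) 0
      ((MeasurableEquiv.piUnique (fun i : Finset.Iic 0 => (fun _ : ℕ => S) i)).symm x) := by
    change Kernel.trajMeasure (X := fun _ => S) (Measure.dirac x) (historyKernel p) = _
    have e : Measure.map (MeasurableEquiv.piUnique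
        (fun i : Finset.Iic 0 => (fun _ : ℕ => S) i)).symm (Measure.dirac x) = Measure.dirac
        ((MeasurableEquiv.piUnique (fun i : Finset.Iic 0 => (fun _ : ℕ => S) i)).symm x) :=
      Measure.map_dirac' (MeasurableEquiv.measurable _) _
    exact (congrArg (fun μ => Measure.bind μ _) e).trans
      (Measure.dirac_bind (Kernel.measurable _) _)
  have h2 := congrFun (congrArg DFunLike.coe
    (Kernel.traj_map_frestrictLe (X := fun _ => S) (κ := historyKernel p) 0 0))
    ((MeasurableEquiv.piUnique (fun i : Finset.Iic 0 => (fun _ : ℕ => S) i)).symm x)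
  rw [Kernel.map_apply _ (by fun_prop), Kernel.partialTraj_self, Kernel.id_apply, ← h] at h2
  have h3 : ∀ᵐ z ∂((pathMeasure x p : Measure (ℕ → S)).map (Preorder.frestrictLe 0)),
      z ⟨0, by simp⟩ = x := by
    rw [h2, ae_dirac_eq]
    rfl
  exact ae_of_ae_map (by fun_prop) h3

end Path

/-! ### Robust expectations and dynamic programming -/

section RobustExpectation

variable {S : Type*} [MeasurableSpace S]

/-- The robust expectation `inf_{μ ∈ P} ∫ f dμ`. -/
noncomputable def infExp (P : Set (ProbabilityMeasure S)) (f : S → ℝ) : ℝ :=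
  ⨅ μ : P, ∫ y, f y ∂(μ.1 : Measure S)

theorem le_infExp {P : Set (ProbabilityMeasure S)} (hP : P.Nonempty) {f : S → ℝ} {c : ℝ}
    (h : ∀ μ ∈ P, c ≤ ∫ y, f y ∂(μ : Measure S)) : c ≤ infExp P f := by
  have := hP.to_subtype
  exact le_ciInf fun μ => h μ.1 μ.2

theorem exists_integral_le_infExp_add {P : Set (ProbabilityMeasure S)} (hP : P.Nonempty)
    (f : S → ℝ) {η : ℝ} (hη : 0 < η) : ∃ μ ∈ P, ∫ y, f y ∂(μ : Measure S) ≤ infExp P f + η := by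
  have := hP.to_subtype
  obtain ⟨μ, hμ⟩ := exists_lt_of_ciInf_lt (lt_add_of_pos_right (infExp P f) hη)
  exact ⟨μ.1, μ.2, hμ.le⟩

variable [Fintype S] [MeasurableSingletonClass S]

theorem le_integral_of_forall_le (μ : Measure S) [IsProbabilityMeasure μ] {f : S → ℝ} {c : ℝ}
    (h : ∀ y, c ≤ f y) : c ≤ ∫ y, f y ∂μ := by
  simpa using integral_mono (μ := μ) (integrable_const c) .of_finite h

theorem integral_le_of_forall_le (μ : Measure S) [IsProbabilityMeasure μ] {f : S → ℝ} {c : ℝ}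
    (h : ∀ y, f y ≤ c) : ∫ y, f y ∂μ ≤ c := by
  simpa using integral_mono (μ := μ) .of_finite (integrable_const c) h

theorem bddBelow_range_integral (P : Set (ProbabilityMeasure S)) (f : S → ℝ) :
    BddBelow (Set.range fun μ : P => ∫ y, f y ∂(μ.1 : Measure S)) := by
  obtain ⟨c, hc⟩ := (Set.finite_range f).bddBelow
  refine ⟨c, ?_⟩
  rintro _ ⟨μ, rfl⟩
  exact le_integral_of_forall_le _ fun y => hc ⟨y, rfl⟩

theorem infExp_le {P : Set (ProbabilityMeasure S)} (f : S → ℝ) {μ : ProbabilityMeasure S}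
    (hμ : μ ∈ P) : infExp P f ≤ ∫ y, f y ∂(μ : Measure S) :=
  ciInf_le (bddBelow_range_integral P f) (⟨μ, hμ⟩ : P)

theorem infExp_le_add {P : Set (ProbabilityMeasure S)} (hP : P.Nonempty) {f g : S → ℝ} {δ : ℝ}
    (h : ∀ y, f y ≤ g y + δ) : infExp P f ≤ infExp P g + δ := by
  rw [← sub_le_iff_le_add]
  refine le_infExp hP fun μ hμ => ?_
  rw [sub_le_iff_le_add]
  refine (infExp_le f hμ).trans ((integral_mono .of_finite .of_finite h).trans_eq ?_)
  rw [integral_add .of_finite .of_finite]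
  simp

theorem abs_infExp_sub_infExp_le {P : Set (ProbabilityMeasure S)} (hP : P.Nonempty)
    {f g : S → ℝ} {δ : ℝ} (h : ∀ y, |f y - g y| ≤ δ) : |infExp P f - infExp P g| ≤ δ := by
  rw [abs_sub_le_iff]
  constructor
  · linarith [infExp_le_add hP (f := f) (g := g) fun y => by linarith [(abs_le.1 (h y)).2]]
  · linarith [infExp_le_add hP (f := g) (g := f) fun y => by linarith [(abs_le.1 (h y)).1]]

theorem abs_ciSup_sub_ciSup_le {ι : Type*} [Finite ι] [Nonempty ι] {f g : ι → ℝ} {δ : ℝ}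
    (h : ∀ i, |f i - g i| ≤ δ) : |(⨆ i, f i) - ⨆ i, g i| ≤ δ := by
  have aux : ∀ {f g : ι → ℝ}, (∀ i, f i ≤ g i + δ) → (⨆ i, f i) ≤ (⨆ i, g i) + δ := fun h =>
    ciSup_le fun i => (h i).trans (by gcongr; exact le_ciSup (Set.finite_range _).bddAbove i)
  rw [abs_sub_le_iff]
  constructor
  · linarith [aux (f := f) (g := g) fun y => by linarith [(abs_le.1 (h y)).2]]
  · linarith [aux (f := g) (g := f) fun y => by linarith [(abs_le.1 (h y)).1]]

end RobustExpectation

section DynamicProgramming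

variable {S A : Type*} [Fintype S]

theorem exists_abs_le_reward [Finite A] (r : S → A → S → ℝ) :
    ∃ C, 0 ≤ C ∧ ∀ x b y, |r x b y| ≤ C := by
  obtain ⟨C, hC⟩ := (Set.finite_range fun z : S × A × S => |r z.1 z.2.1 z.2.2|).bddAbove
  exact ⟨max C 0, le_max_right _ _, fun x b y => (hC ⟨(x, b, y), rfl⟩).trans (le_max_left _ _)⟩

variable [MeasurableSpace S] [MeasurableSingletonClass S]

/-- The expected discounted total reward of a policy under a path measure. -/
noncomputable def discountedValue (α : ℝ) (r : S → A → S → ℝ) (a : ℕ → S → A)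
    (μ : ProbabilityMeasure (ℕ → S)) : ℝ :=
  ∫ ω, ∑' t : ℕ, α ^ t * r (ω t) (a t (ω t)) (ω (t + 1)) ∂(μ : Measure (ℕ → S))

/-- The expected one-step gain at time `t` in the state `y` when `v` is used as
continuation value. -/
noncomputable def stepGain (α : ℝ) (r : S → A → S → ℝ) (a : ℕ → S → A)
    (p : ℕ → S → ProbabilityMeasure S) (v : S → ℝ) (t : ℕ) (y : S) : ℝ :=
  ∫ z, (r y (a t y) z + α * v z) ∂(p t y : Measure S) - v y

/-- Replacing rewards by step gains changes the discounted sum by the telescoping series of the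
`α ^ t * E v(X_t)`, so the discounted step gains sum to the value minus `v x`. -/
theorem tendsto_sum_stepGain [Finite A] {α : ℝ} (hα0 : 0 < α) (hα1 : α < 1) (r : S → A → S → ℝ)
    (a : ℕ → S → A) (p : ℕ → S → ProbabilityMeasure S) (v : S → ℝ) (x : S) :
    Tendsto (fun n => ∑ t ∈ Finset.range n,
        α ^ t * ∫ ω, stepGain α r a p v t (ω t) ∂(pathMeasure x p : Measure (ℕ → S))) atTop
      (𝓝 (discountedValue α r a (pathMeasure x p) - v x)) := by
  set μ : Measure (ℕ → S) := (pathMeasure x p : Measure (ℕ → S)) with hμ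
  obtain ⟨C, hC0, hC⟩ := exists_abs_le_reward r
  have hdep : ∀ t, DependsOn (fun ω : ℕ → S => r (ω t) (a t (ω t)) (ω (t + 1)))
      (Set.Iic (t + 1)) := fun t ω ω' h => by
    simp only [h t (Nat.le_succ t), h (t + 1) (le_refl (t + 1))]
  have hint : ∀ t, Integrable (fun ω : ℕ → S => α ^ t * r (ω t) (a t (ω t)) (ω (t + 1))) μ :=
    fun t => (integrable_of_dependsOn (hdep t)).const_mul _
  have hsum : Summable fun t => ∫ ω, ‖α ^ t * r (ω t) (a t (ω t)) (ω (t + 1))‖ ∂μ := by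
    refine Summable.of_nonneg_of_le (fun t => integral_nonneg fun _ => norm_nonneg _) (fun t => ?_)
      ((summable_geometric_of_lt_one hα0.le hα1).mul_right C)
    have : ∫ ω, ‖α ^ t * r (ω t) (a t (ω t)) (ω (t + 1))‖ ∂μ ≤ ∫ ω, α ^ t * C ∂μ := by
      refine integral_mono (hint t).norm (integrable_const _) fun ω => ?_
      simp only [norm_mul, norm_pow, Real.norm_eq_abs, abs_of_pos hα0]
      gcongr
      exact hC _ _ _
    simpa using this
  have h1 := (hasSum_integral_of_summable_integral_norm hint hsum).tendsto_sum_nat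
  -- the values `E v(X_t)` telescope
  have hstep : ∀ t, ∫ ω, α ^ t * r (ω t) (a t (ω t)) (ω (t + 1)) ∂μ =
      α ^ t * ∫ ω, stepGain α r a p v t (ω t) ∂μ
        + (α ^ t * ∫ ω, v (ω t) ∂μ - α ^ (t + 1) * ∫ ω, v (ω (t + 1)) ∂μ) := by
    intro t
    have h2 := integral_pathMeasure_succ x p t
      (fun ω z => r (ω t) (a t (ω t)) z + α * v z) (fun z ω ω' h => by simp only [h t (le_refl t)])
    rw [← hμ] at h2
    have h3 : ∫ ω, stepGain α r a p v t (ω t) ∂μ =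
        ∫ ω, ∫ z, (r (ω t) (a t (ω t)) z + α * v z) ∂(p t (ω t) : Measure S) ∂μ
          - ∫ ω, v (ω t) ∂μ :=
      integral_sub (integrable_of_dependsOn (dependsOn_eval (le_refl t)
          fun y => ∫ z, (r y (a t y) z + α * v z) ∂(p t y : Measure S)))
        (integrable_of_dependsOn (dependsOn_eval (le_refl t) v))
    rw [h3, ← h2, integral_add (integrable_of_dependsOn (hdep t))
      ((integrable_of_dependsOn (dependsOn_eval (le_refl (t + 1)) v)).const_mul _),
      integral_const_mul, integral_const_mul]
    ring
  have h0 : ∫ ω, v (ω 0) ∂μ = v x := by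
    have : ∫ ω, v (ω 0) ∂μ = ∫ ω, v x ∂μ :=
      integral_congr_ae ((ae_pathMeasure_zero x p).mono fun ω h => by simp only [h])
    simpa using this
  have hvlim : Tendsto (fun n => α ^ n * ∫ ω, v (ω n) ∂μ) atTop (𝓝 0) := by
    obtain ⟨B, hB⟩ := (Set.finite_range fun y => |v y|).bddAbove
    refine squeeze_zero_norm (a := fun n => α ^ n * B) (fun n => ?_) ?_
    · rw [norm_mul, norm_pow, Real.norm_eq_abs α, abs_of_pos hα0]
      gcongr
      refine (norm_integral_le_of_norm_le_const (.of_forall fun ω => hB ⟨ω n, rfl⟩)).trans ?_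
      simp
    · simpa using (tendsto_pow_atTop_nhds_zero_of_lt_one hα0.le hα1).mul_const B
  have h4 : ∀ n, ∑ t ∈ Finset.range n, α ^ t * ∫ ω, stepGain α r a p v t (ω t) ∂μ =
      ∑ t ∈ Finset.range n, ∫ ω, α ^ t * r (ω t) (a t (ω t)) (ω (t + 1)) ∂μ
        - (v x - α ^ n * ∫ ω, v (ω n) ∂μ) := by
    intro n
    rw [Finset.sum_congr rfl fun t _ => hstep t, Finset.sum_add_distrib,
      Finset.sum_range_sub' (fun t => α ^ t * ∫ ω, v (ω t) ∂μ), h0]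
    ring
  simp_rw [h4]
  simpa [discountedValue] using h1.sub (tendsto_const_nhds.sub hvlim)

theorem le_discountedValue [Finite A] {α : ℝ} (hα0 : 0 < α) (hα1 : α < 1) (r : S → A → S → ℝ)
    (a : ℕ → S → A) (p : ℕ → S → ProbabilityMeasure S) (v : S → ℝ) (x : S) {η : ℝ}
    (h : ∀ t y, η ≤ stepGain α r a p v t y) :
    v x + η / (1 - α) ≤ discountedValue α r a (pathMeasure x p) := by
  have h1 : Tendsto (fun n => ∑ t ∈ Finset.range n, α ^ t * η) atTop (𝓝 (η / (1 - α))) := by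
    have := ((hasSum_geometric_of_lt_one hα0.le hα1).mul_right η).tendsto_sum_nat
    rwa [inv_mul_eq_div] at this
  have := le_of_tendsto_of_tendsto' h1 (tendsto_sum_stepGain hα0 hα1 r a p v x) fun n => by
    refine Finset.sum_le_sum fun t _ => ?_
    gcongr
    have := integral_mono (μ := (pathMeasure x p : Measure (ℕ → S))) (integrable_const η)
      (integrable_of_dependsOn (dependsOn_eval (le_refl t) _)) fun ω => h t (ω t)
    simpa using this
  linarith

theorem discountedValue_le [Finite A] {α : ℝ} (hα0 : 0 < α) (hα1 : α < 1) (r : S → A → S → ℝ)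
    (a : ℕ → S → A) (p : ℕ → S → ProbabilityMeasure S) (v : S → ℝ) (x : S) {η : ℝ}
    (h : ∀ t y, stepGain α r a p v t y ≤ η) :
    discountedValue α r a (pathMeasure x p) ≤ v x + η / (1 - α) := by
  have h1 : Tendsto (fun n => ∑ t ∈ Finset.range n, α ^ t * η) atTop (𝓝 (η / (1 - α))) := by
    have := ((hasSum_geometric_of_lt_one hα0.le hα1).mul_right η).tendsto_sum_nat
    rwa [inv_mul_eq_div] at this
  have := le_of_tendsto_of_tendsto' (tendsto_sum_stepGain hα0 hα1 r a p v x) h1 fun n => by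
    refine Finset.sum_le_sum fun t _ => ?_
    gcongr
    have := integral_mono (μ := (pathMeasure x p : Measure (ℕ → S)))
      (integrable_of_dependsOn (dependsOn_eval (le_refl t) _)) (integrable_const η)
      fun ω => h t (ω t)
    simpa using this
  linarith

/-- Verification theorem: a fixed point of the robust Bellman operator is the robust value
function. -/
theorem robustValue_eq_of_isFixedPt [Finite A] [Nonempty A] {α : ℝ} (hα0 : 0 < α) (hα1 : α < 1)
    (r : S → A → S → ℝ) (P : S → A → Set (ProbabilityMeasure S)) (hP : ∀ x b, (P x b).Nonempty)
    (v : S → ℝ) (hv : ∀ x, v x = ⨆ b, infExp (P x b) fun y => r x b y + α * v y) (x : S) :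
    robustValue α r P x = v x := by
  obtain ⟨C, hC0, hC⟩ := exists_abs_le_reward r
  have h1α : 0 < 1 - α := by linarith
  have hne : ∀ a : ℕ → S → A, Nonempty (admissibleMeasures P x a) := fun a => by
    choose p hp using fun (t : ℕ) (y : S) => hP y (a t y)
    exact ⟨⟨_, p, hp, rfl⟩⟩
  have hbdd : ∀ a : ℕ → S → A, BddBelow (Set.range fun μ : admissibleMeasures P x a =>
      discountedValue α r a μ.1) := by
    refine fun a => ⟨0 + -C / (1 - α), ?_⟩
    rintro _ ⟨⟨_, p, hp, rfl⟩, rfl⟩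
    refine le_discountedValue hα0 hα1 r a p (fun _ => 0) x fun t y => ?_
    simp only [stepGain, mul_zero, add_zero, sub_zero]
    exact le_integral_of_forall_le _ fun z => (abs_le.1 (hC _ _ _)).1
  have hupper : ∀ a : ℕ → S → A,
      ⨅ μ : admissibleMeasures P x a, discountedValue α r a μ.1 ≤ v x := by
    intro a
    refine le_of_forall_pos_le_add fun δ hδ => ?_
    choose p hp hpi using fun (t : ℕ) (y : S) => exists_integral_le_infExp_add (hP y (a t y))
      (fun z => r y (a t y) z + α * v z) (mul_pos hδ h1α)
    refine (ciInf_le (hbdd a) (⟨_, p, hp, rfl⟩ : admissibleMeasures P x a)).trans ?_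
    refine (discountedValue_le hα0 hα1 r a p v x (η := δ * (1 - α)) fun t y => ?_).trans_eq ?_
    · have : infExp (P y (a t y)) (fun z => r y (a t y) z + α * v z) ≤ v y := by
        rw [hv y]
        exact le_ciSup (f := fun b => infExp (P y b) fun z => r y b z + α * v z)
          (Set.finite_range _).bddAbove (a t y)
      have := hpi t y
      simp only [stepGain]
      linarith
    · rw [mul_div_cancel_right₀ _ h1α.ne']
  refine le_antisymm (ciSup_le hupper) ?_
  -- a greedy stationary policy attains the fixed point
  choose g hg using fun y => exists_eq_ciSup_of_finite
    (f := fun b => infExp (P y b) fun z => r y b z + α * v z)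
  refine le_trans ?_ (le_ciSup (f := fun a : ℕ → S → A =>
    ⨅ μ : admissibleMeasures P x a, discountedValue α r a μ.1)
    ⟨v x, by rintro _ ⟨a, rfl⟩; exact hupper a⟩ fun _ => g)
  have := hne fun _ => g
  refine le_ciInf ?_
  rintro ⟨_, p, hp, rfl⟩
  have := le_discountedValue hα0 hα1 r (fun _ => g) p v x (η := 0) fun t y => by
    have h1 := infExp_le (fun z => r y (g y) z + α * v z) (hp t y)
    have h2 := hg y
    rw [← hv y] at h2
    simp only [stepGain]
    linarith
  simpa using this

theorem exists_bellman_fixedPoint [Finite A] [Nonempty A] {α : ℝ} (hα0 : 0 < α) (hα1 : α < 1)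
    (r : S → A → S → ℝ) (P : S → A → Set (ProbabilityMeasure S))
    (hP : ∀ x b, (P x b).Nonempty) :
    ∃ v : S → ℝ, ∀ x, v x = ⨆ b, infExp (P x b) fun y => r x b y + α * v y := by
  let T : (S → ℝ) → S → ℝ := fun v x => ⨆ b, infExp (P x b) fun y => r x b y + α * v y
  have hT : ContractingWith ⟨α, hα0.le⟩ T := by
    refine ⟨by exact_mod_cast hα1, LipschitzWith.of_dist_le_mul fun v w => ?_⟩
    refine (dist_pi_le_iff (by positivity)).2 fun x => ?_
    rw [Real.dist_eq]
    refine abs_ciSup_sub_ciSup_le fun b => abs_infExp_sub_infExp_le (hP x b) fun y => ?_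
    rw [add_sub_add_left_eq_sub, ← mul_sub, abs_mul, abs_of_pos hα0]
    exact mul_le_mul_of_nonneg_left (dist_le_pi_dist v w y) hα0.le
  exact ⟨hT.fixedPoint T, fun x => (congrFun hT.fixedPoint_isFixedPt x).symm⟩

/-- The optimal `Q`-function is a fixed point of the robust `Q`-operator. -/
theorem optimalQ_eq_infExp [Finite A] [Nonempty A] {α : ℝ} (hα0 : 0 < α) (hα1 : α < 1)
    (r : S → A → S → ℝ) (P : S → A → Set (ProbabilityMeasure S))
    (hP : ∀ x b, (P x b).Nonempty) (x : S) (b : A) :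
    optimalQ α r P x b = infExp (P x b) (target α r (optimalQ α r P) x b) := by
  obtain ⟨v, hv⟩ := exists_bellman_fixedPoint hα0 hα1 r P hP
  have h1 := robustValue_eq_of_isFixedPt hα0 hα1 r P hP v hv
  have h2 : ∀ x b, optimalQ α r P x b = infExp (P x b) fun y => r x b y + α * v y := fun x b => by
    simp only [optimalQ, infExp, h1]
  have h3 : ∀ y, ⨆ b', optimalQ α r P y b' = v y := fun y => by simp only [h2, ← hv y]
  rw [h2]
  exact congrArg (infExp (P x b)) (funext fun y => by simp only [target, h3])

end DynamicProgramming

/-! ### Wasserstein duality on finite spaces -/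

section Duality

/-- If `D` is the minimum of finitely many affine functions `l ↦ F i + l * G i`, then at a maximizer
of `D` over `l ≥ 0` some convex combination of two of these functions has nonpositive slope and
constant term at most `max D`. This is linear programming duality for a single constraint. -/
theorem exists_convexCombination_of_isMaxOn {I : Type*} [Finite I] (F G : I → ℝ) (D : ℝ → ℝ)
    (hle : ∀ l, 0 ≤ l → ∀ i, D l ≤ F i + l * G i)
    (heq : ∀ l, 0 ≤ l → ∃ i, D l = F i + l * G i)
    {l : ℝ} (hl : 0 ≤ l) (hmax : IsMaxOn D (Set.Ici 0) l) :
    ∃ i j, ∃ θ : ℝ, 0 ≤ θ ∧ θ ≤ 1 ∧ θ * G i + (1 - θ) * G j ≤ 0 ∧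
      θ * F i + (1 - θ) * F j ≤ D l := by
  have hnot : ∀ s, 0 ≤ s → ¬ ∀ i, D l < F i + s * G i := fun s hs h => by
    obtain ⟨i, hi⟩ := heq s hs
    have h1 : D s ≤ D l := hmax hs
    linarith [h i]
  have hcont : ∀ i, Continuous fun s => F i + s * G i := fun i => by fun_prop
  -- to the right of `l` the function `D` does not increase
  have hright : ∃ i, D l = F i + l * G i ∧ G i ≤ 0 := by
    by_contra! hcon
    have hev : ∀ᶠ s in 𝓝[>] l, ∀ i, D l < F i + s * G i := by
      refine eventually_all.2 fun i => ?_
      rcases (hle l hl i).eq_or_lt with h | h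
      · filter_upwards [self_mem_nhdsWithin] with s hs
        have := mul_lt_mul_of_pos_right (Set.mem_Ioi.1 hs) (hcon i h)
        linarith
      · exact ((hcont i).tendsto l).eventually_const_lt h |>.filter_mono nhdsWithin_le_nhds
    obtain ⟨s, hs, hs'⟩ := (hev.and self_mem_nhdsWithin).exists
    exact hnot s (hl.trans (le_of_lt hs')) hs
  obtain ⟨i, hi, hGi⟩ := hright
  rcases hl.eq_or_lt with rfl | hpos
  · exact ⟨i, i, 1, zero_le_one, le_rfl, by simpa using hGi, by simp [hi]⟩
  -- to the left of `l` it does not decrease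
  have hleft : ∃ j, D l = F j + l * G j ∧ 0 ≤ G j := by
    by_contra! hcon
    have hev : ∀ᶠ s in 𝓝[<] l, ∀ i, D l < F i + s * G i := by
      refine eventually_all.2 fun i => ?_
      rcases (hle l hl i).eq_or_lt with h | h
      · filter_upwards [self_mem_nhdsWithin] with s hs
        have := mul_lt_mul_of_neg_right (Set.mem_Iio.1 hs) (hcon i h)
        linarith
      · exact ((hcont i).tendsto l).eventually_const_lt h |>.filter_mono nhdsWithin_le_nhds
    obtain ⟨s, hs, hs'⟩ := (hev.and ((eventually_gt_nhds hpos).filter_mono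
      nhdsWithin_le_nhds)).exists
    exact hnot s (le_of_lt hs') hs
  obtain ⟨j, hj, hGj⟩ := hleft
  have hcomb : ∃ θ : ℝ, 0 ≤ θ ∧ θ ≤ 1 ∧ θ * G i + (1 - θ) * G j = 0 := by
    rcases hGj.eq_or_lt with h | h
    · exact ⟨0, le_rfl, zero_le_one, by simp [← h]⟩
    · have hd : 0 < G j - G i := by linarith
      refine ⟨G j / (G j - G i), by positivity, (div_le_one hd).2 (by linarith), ?_⟩
      field_simp
      ring
  obtain ⟨θ, h0, h1, h2⟩ := hcomb
  refine ⟨i, j, θ, h0, h1, h2.le, ?_⟩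
  linear_combination -θ * hi - (1 - θ) * hj - l * h2

section Transform

variable {S : Type*} [Finite S] {c : S → S → ℝ≥0∞}

/-- `-(-f)^{lc}(y)` is a lower bound of `f z + l * c y z` over the `z` at finite cost from `y`;
it is attained by `exists_neg_lambdaCTransform_eq`. -/
theorem neg_lambdaCTransform_le (l : ℝ) (f : S → ℝ) {y z : S} (h : c y z ≠ ∞) :
    -lambdaCTransform c l (fun z => -f z) y ≤ f z + l * (c y z).toReal := by
  have := le_ciSup (f := fun z : {z : S // c y z ≠ ∞} => -f z - l * (c y z).toReal)
    (Set.finite_range _).bddAbove ⟨z, h⟩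
  simp only [lambdaCTransform]
  linarith

theorem exists_neg_lambdaCTransform_eq (l : ℝ) (f : S → ℝ) {y : S} (h : c y y = 0) :
    ∃ z, c y z ≠ ∞ ∧ -lambdaCTransform c l (fun z => -f z) y = f z + l * (c y z).toReal := by
  have : Nonempty {z : S // c y z ≠ ∞} := ⟨⟨y, by simp [h]⟩⟩
  obtain ⟨z, hz⟩ := exists_eq_ciSup_of_finite
    (f := fun z : {z : S // c y z ≠ ∞} => -f z - l * (c y z).toReal)
  refine ⟨z.1, z.2, ?_⟩
  rw [lambdaCTransform, ← hz]
  ring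

end Transform

variable {E : Type*} [NormedAddCommGroup E] {X : Finset E}

theorem normCost_ne_top (q : ℕ) (x y : X) : normCost q x y ≠ ∞ := ENNReal.ofReal_ne_top

theorem toReal_normCost (q : ℕ) (x y : X) : (normCost q x y).toReal = ‖(x : E) - y‖ ^ q :=
  ENNReal.toReal_ofReal (by positivity)

theorem normCost_self {q : ℕ} (hq : 1 ≤ q) (x : X) : normCost q x x = 0 := by
  simp [normCost, show q ≠ 0 by omega]

variable [MeasurableSpace X]

theorem mem_wassersteinBall_iff {q : ℕ} (hq : 1 ≤ q) {ε : ℝ} (hε : 0 < ε)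
    {μ ν : ProbabilityMeasure X} : μ ∈ wassersteinBall q ε ν ↔
      ⨅ π ∈ couplings μ ν, ∫⁻ z, normCost q z.1 z.2 ∂(π : Measure (X × X)) ≤
        ENNReal.ofReal (ε ^ q) := by
  have hq' : (0 : ℝ) < q := by exact_mod_cast hq
  rw [wassersteinBall, Set.mem_ofPred_eq, wasserstein, one_div, ENNReal.rpow_inv_le_iff hq',
    ENNReal.rpow_natCast, ENNReal.ofReal_pow hε.le]

variable [MeasurableSingletonClass X]

theorem self_mem_wassersteinBall {q : ℕ} (hq : 1 ≤ q) {ε : ℝ} (hε : 0 < ε)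
    (μ : ProbabilityMeasure X) : μ ∈ wassersteinBall q ε μ := by
  rw [mem_wassersteinBall_iff hq hε]
  have hm : Measurable fun y : X => (y, y) := Measurable.of_discrete
  let π : ProbabilityMeasure (X × X) := μ.map hm.aemeasurable
  have hπ : (π : Measure (X × X)) = (μ : Measure X).map fun y => (y, y) := rfl
  refine (iInf₂_le π ⟨?_, ?_⟩).trans ?_
  · rw [hπ, lintegral_map Measurable.of_discrete hm]
    simp [normCost_self hq]
  · rw [hπ, Measure.map_map measurable_fst hm]
    exact Measure.map_id
  · rw [hπ, Measure.map_map measurable_snd hm]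
    exact Measure.map_id

/-- Weak duality. -/
theorem integral_sub_le_integral_of_mem_wassersteinBall {q : ℕ} (hq : 1 ≤ q) {ε : ℝ} (hε : 0 < ε)
    {μ ν : ProbabilityMeasure X} (hμ : μ ∈ wassersteinBall q ε ν) {f φ : X → ℝ} {l : ℝ}
    (hl : 0 ≤ l) (hφ : ∀ y z : X, φ y ≤ f z + l * ‖(y : E) - z‖ ^ q) :
    ∫ y, φ y ∂(ν : Measure X) - ε ^ q * l ≤ ∫ y, f y ∂(μ : Measure X) := by
  rw [mem_wassersteinBall_iff hq hε] at hμ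
  refine le_of_forall_pos_le_add fun η hη => ?_
  have hδ : 0 < η / (l + 1) := by positivity
  have hlt : ⨅ π ∈ couplings μ ν, ∫⁻ z, normCost q z.1 z.2 ∂(π : Measure (X × X)) <
      ENNReal.ofReal (ε ^ q + η / (l + 1)) :=
    hμ.trans_lt ((ENNReal.ofReal_lt_ofReal_iff (by positivity)).2 (by linarith))
  simp only [iInf_lt_iff] at hlt
  obtain ⟨π, ⟨h1, h2⟩, h3⟩ := hlt
  have hcost : ∫ z, ‖(z.1 : E) - z.2‖ ^ q ∂(π : Measure (X × X)) ≤ ε ^ q + η / (l + 1) := by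
    have := ofReal_integral_eq_lintegral_ofReal (μ := (π : Measure (X × X)))
      (f := fun z : X × X => ‖(z.1 : E) - z.2‖ ^ q) .of_finite (.of_forall fun z => by positivity)
    simp only [normCost, ← this] at h3
    exact ((ENNReal.ofReal_lt_ofReal_iff (by positivity)).1 h3).le
  have e1 : ∫ y, φ y ∂(ν : Measure X) = ∫ z, φ z.2 ∂(π : Measure (X × X)) := by
    rw [← h2, integral_map measurable_snd.aemeasurable
      Measurable.of_discrete.aestronglyMeasurable]
  have e2 : ∫ y, f y ∂(μ : Measure X) = ∫ z, f z.1 ∂(π : Measure (X × X)) := by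
    rw [← h1, integral_map measurable_fst.aemeasurable
      Measurable.of_discrete.aestronglyMeasurable]
  have h4 : ∫ z, φ z.2 ∂(π : Measure (X × X)) ≤
      ∫ z, (f z.1 + l * ‖(z.1 : E) - z.2‖ ^ q) ∂(π : Measure (X × X)) :=
    integral_mono .of_finite .of_finite fun z => by
      have := hφ z.2 z.1
      rwa [norm_sub_rev] at this
  rw [integral_add .of_finite .of_finite, integral_const_mul] at h4
  have h5 := mul_le_mul_of_nonneg_left hcost hl
  have h6 : l * (η / (l + 1)) ≤ η := by
    rw [mul_div_assoc', div_le_iff₀ (by linarith)]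
    nlinarith
  rw [e1, e2]
  nlinarith

/-- A mixture of two transport maps within the transport budget gives a measure in the Wasserstein
ball. -/
theorem exists_mem_wassersteinBall_of_maps {q : ℕ} (hq : 1 ≤ q) {ε : ℝ} (hε : 0 < ε)
    (ν : ProbabilityMeasure X) (f : X → ℝ) (u v : X → X) {θ : ℝ} (h0 : 0 ≤ θ) (h1 : θ ≤ 1)
    (hcost : θ * ∫ y, ‖(y : E) - u y‖ ^ q ∂(ν : Measure X)
      + (1 - θ) * ∫ y, ‖(y : E) - v y‖ ^ q ∂(ν : Measure X) ≤ ε ^ q) :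
    ∃ μ ∈ wassersteinBall q ε ν, ∫ y, f y ∂(μ : Measure X) =
      θ * ∫ y, f (u y) ∂(ν : Measure X) + (1 - θ) * ∫ y, f (v y) ∂(ν : Measure X) := by
  have hm : ∀ w : X → X, Measurable fun y => (w y, y) := fun w => Measurable.of_discrete
  let m : Measure (X × X) := ENNReal.ofReal θ • (ν : Measure X).map (fun y => (u y, y)) +
    ENNReal.ofReal (1 - θ) • (ν : Measure X).map (fun y => (v y, y))
  have hm1 : IsProbabilityMeasure m := by
    refine ⟨?_⟩
    simp only [m, Measure.add_apply, Measure.smul_apply, Measure.map_apply (hm _) .univ,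
      Set.preimage_univ, measure_univ, smul_eq_mul, mul_one]
    rw [← ENNReal.ofReal_add h0 (by linarith)]
    simp
  have hint : ∀ g : X × X → ℝ, ∫ z, g z ∂m = θ * ∫ y, g (u y, y) ∂(ν : Measure X) +
      (1 - θ) * ∫ y, g (v y, y) ∂(ν : Measure X) := fun g => by
    have hmap : ∀ w : X → X, ∫ z, g z ∂((ν : Measure X).map fun y => (w y, y)) =
        ∫ y, g (w y, y) ∂(ν : Measure X) := fun w =>
      integral_map (hm w).aemeasurable Measurable.of_discrete.aestronglyMeasurable
    have : ∀ w : X → X, IsFiniteMeasure ((ν : Measure X).map fun y => (w y, y)) := fun w =>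
      inferInstance
    rw [integral_add_measure (Integrable.of_finite.smul_measure ENNReal.ofReal_ne_top)
      (Integrable.of_finite.smul_measure ENNReal.ofReal_ne_top), integral_smul_measure,
      integral_smul_measure, hmap, hmap, ENNReal.toReal_ofReal h0,
      ENNReal.toReal_ofReal (by linarith), smul_eq_mul, smul_eq_mul]
  have hsnd : m.map Prod.snd = ν := by
    simp only [m, Measure.map_add _ _ measurable_snd, Measure.map_smul,
      Measure.map_map measurable_snd (hm _)]
    have : ∀ w : X → X, Prod.snd ∘ (fun y => (w y, y)) = id := fun w => rfl
    simp only [this, Measure.map_id]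
    rw [← add_smul, ← ENNReal.ofReal_add h0 (by linarith)]
    simp
  let π : ProbabilityMeasure (X × X) := ⟨m, hm1⟩
  let μ : ProbabilityMeasure X := π.map measurable_fst.aemeasurable
  refine ⟨μ, ?_, ?_⟩
  · rw [mem_wassersteinBall_iff hq hε]
    refine (iInf₂_le π ⟨rfl, hsnd⟩).trans ?_
    have := ofReal_integral_eq_lintegral_ofReal (μ := m)
      (f := fun z : X × X => ‖(z.1 : E) - z.2‖ ^ q) .of_finite (.of_forall fun z => by positivity)
    change ∫⁻ z, normCost q z.1 z.2 ∂m ≤ _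
    simp only [normCost, ← this]
    refine ENNReal.ofReal_le_ofReal ?_
    rw [hint]
    simpa only [norm_sub_rev] using hcost
  · change ∫ y, f y ∂(m.map Prod.fst) = _
    rw [integral_map measurable_fst.aemeasurable Measurable.of_discrete.aestronglyMeasurable, hint]

/-- The dual value at an optimal multiplier is the robust expectation over the Wasserstein ball. -/
theorem integral_lambdaCTransform_eq_infExp_wassersteinBall {q : ℕ} (hq : 1 ≤ q) {ε : ℝ}
    (hε : 0 < ε) (ν : ProbabilityMeasure X) (f : X → ℝ) {l : ℝ} (hl : 0 ≤ l)
    (hmax : IsMaxOn (fun l => ∫ y, (-lambdaCTransform (normCost q) l (fun z => -f z) y - ε ^ q * l)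
      ∂(ν : Measure X)) (Set.Ici 0) l) :
    ∫ y, (-lambdaCTransform (normCost q) l (fun z => -f z) y - ε ^ q * l) ∂(ν : Measure X) =
      infExp (wassersteinBall q ε ν) f := by
  have hD : ∀ l, ∫ y, (-lambdaCTransform (normCost q) l (fun z => -f z) y - ε ^ q * l)
      ∂(ν : Measure X) =
      ∫ y, -lambdaCTransform (normCost q) l (fun z => -f z) y ∂(ν : Measure X) - ε ^ q * l :=
    fun l => by
      rw [integral_sub .of_finite .of_finite]
      simp
  have hle : ∀ (l : ℝ) (y z : X), -lambdaCTransform (normCost q) l (fun z => -f z) y ≤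
      f z + l * ‖(y : E) - z‖ ^ q := fun l y z => by
    rw [← toReal_normCost]
    exact neg_lambdaCTransform_le l f (normCost_ne_top q y z)
  have hFG : ∀ (l : ℝ) (w : X → X), ∫ y, (f (w y) + l * ‖(y : E) - w y‖ ^ q) ∂(ν : Measure X) =
      ∫ y, f (w y) ∂(ν : Measure X) + l * ∫ y, ‖(y : E) - w y‖ ^ q ∂(ν : Measure X) :=
    fun l w => by rw [integral_add .of_finite .of_finite, integral_const_mul]
  refine le_antisymm (le_infExp ⟨ν, self_mem_wassersteinBall hq hε ν⟩ fun μ hμ => ?_) ?_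
  · rw [hD]
    exact integral_sub_le_integral_of_mem_wassersteinBall hq hε hμ hl (hle l)
  obtain ⟨u, v, θ, h0, h1, h2, h3⟩ := exists_convexCombination_of_isMaxOn
    (fun w : X → X => ∫ y, f (w y) ∂(ν : Measure X))
    (fun w : X → X => ∫ y, ‖(y : E) - w y‖ ^ q ∂(ν : Measure X) - ε ^ q) _
    (fun l _ w => by
      have := integral_mono (μ := (ν : Measure X)) .of_finite .of_finite fun y => hle l y (w y)
      rw [hFG] at this
      exact (hD l).trans_le (by linarith))
    (fun l _ => by
      choose w _ hw using fun y : X =>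
        exists_neg_lambdaCTransform_eq (c := normCost q) l f (normCost_self hq y)
      refine ⟨w, (hD l).trans ?_⟩
      simp only [hw, toReal_normCost]
      rw [hFG]
      ring)
    hl hmax
  obtain ⟨μ, hμ, h4⟩ := exists_mem_wassersteinBall_of_maps hq hε ν f u v h0 h1 (by linarith)
  exact (infExp_le f hμ).trans (h4.trans_le h3)

end Duality

/-! ### Almost sure convergence of sums of centred increments -/

section NoiseConvergence

variable {S : Type*}

theorem dependsOn_sum_eval_succ {g : ℕ → (ℕ → S) → S → ℝ}
    (hg : ∀ t y, DependsOn (fun ω => g t ω y) (Set.Iic t)) (n : ℕ) :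
    DependsOn (fun ω => ∑ t ∈ Finset.range n, g t ω (ω (t + 1))) (Set.Iic n) := by
  intro ω ω' h
  refine Finset.sum_congr rfl fun t ht => ?_
  have ht' : t + 1 ≤ n := Finset.mem_range.1 ht
  rw [h (t + 1) ht']
  exact hg t _ fun i hi => h i (le_trans (show i ≤ t from hi) (by omega))

variable [Fintype S] [MeasurableSpace S] [MeasurableSingletonClass S]

/-- Products of a centred increment with a function of the past integrate to zero. -/
theorem integral_mul_increment_eq_zero (x : S) (p : ℕ → S → ProbabilityMeasure S) {t : ℕ}
    {g : (ℕ → S) → S → ℝ} (hg : ∀ y, DependsOn (fun ω => g ω y) (Set.Iic t))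
    (h0 : ∀ ω, ∫ y, g ω y ∂(p t (ω t) : Measure S) = 0)
    {φ : (ℕ → S) → ℝ} (hφ : DependsOn φ (Set.Iic t)) :
    ∫ ω, φ ω * g ω (ω (t + 1)) ∂(pathMeasure x p : Measure (ℕ → S)) = 0 := by
  rw [integral_pathMeasure_succ x p t (fun ω y => φ ω * g ω y)
    (fun y ω ω' h => congrArg₂ (· * ·) (hφ h) (hg y h))]
  simp [integral_const_mul, h0]

/-- Centred increments are orthogonal, so their second moments add up. -/
theorem integral_sq_sum_increments_le (x : S) (p : ℕ → S → ProbabilityMeasure S)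
    {g : ℕ → (ℕ → S) → S → ℝ} {k : ℕ → (ℕ → S) → ℝ} {C : ℝ}
    (hg : ∀ t y, DependsOn (fun ω => g t ω y) (Set.Iic t))
    (hk : ∀ t, DependsOn (k t) (Set.Iic t))
    (h0 : ∀ t ω, ∫ y, g t ω y ∂(p t (ω t) : Measure S) = 0)
    (hgk : ∀ t ω y, |g t ω y| ≤ C * k t ω) (n : ℕ) :
    ∫ ω, (∑ t ∈ Finset.range n, g t ω (ω (t + 1))) ^ 2 ∂(pathMeasure x p : Measure (ℕ → S)) ≤
      ∫ ω, C ^ 2 * ∑ t ∈ Finset.range n, k t ω ^ 2 ∂(pathMeasure x p : Measure (ℕ → S)) := by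
  set μ : Measure (ℕ → S) := (pathMeasure x p : Measure (ℕ → S))
  induction n with
  | zero => simp
  | succ n ih =>
    have hM := dependsOn_sum_eval_succ hg n
    have hξ : DependsOn (fun ω => g n ω (ω (n + 1))) (Set.Iic (n + 1)) := fun ω ω' h => by
      have h1 := hg n (ω' (n + 1)) fun i hi => h i (le_trans hi (Nat.le_succ n))
      change g n ω (ω (n + 1)) = g n ω' (ω' (n + 1))
      rw [h (n + 1) (le_refl (n + 1))]
      exact h1
    have hK : DependsOn (fun ω => ∑ t ∈ Finset.range n, k t ω ^ 2) (Set.Iic n) := fun ω ω' h =>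
      Finset.sum_congr rfl fun t ht => by
        rw [hk t fun i hi => h i (le_trans hi (Finset.mem_range.1 ht).le)]
    have i1 : Integrable (fun ω => (∑ t ∈ Finset.range n, g t ω (ω (t + 1))) ^ 2) μ :=
      integrable_of_dependsOn (t := n) fun ω ω' h => congrArg (· ^ 2) (hM h)
    have i2 : Integrable (fun ω => (∑ t ∈ Finset.range n, g t ω (ω (t + 1))) *
        g n ω (ω (n + 1))) μ :=
      integrable_of_dependsOn (t := n + 1) fun ω ω' h =>
        congrArg₂ (· * ·) (hM fun i hi => h i (le_trans hi (Nat.le_succ n))) (hξ h)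
    have i3 : Integrable (fun ω => g n ω (ω (n + 1)) ^ 2) μ :=
      integrable_of_dependsOn (t := n + 1) fun ω ω' h => congrArg (· ^ 2) (hξ h)
    have i4 : Integrable (fun ω => C ^ 2 * ∑ t ∈ Finset.range n, k t ω ^ 2) μ :=
      (integrable_of_dependsOn hK).const_mul _
    have i5 : Integrable (fun ω => C ^ 2 * k n ω ^ 2) μ :=
      Integrable.const_mul (integrable_of_dependsOn (t := n) fun ω ω' h =>
        congrArg (· ^ 2) (hk n h)) _
    have hcross := integral_mul_increment_eq_zero x p (hg n) (h0 n) hM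
    have e1 : ∀ ω, (∑ t ∈ Finset.range (n + 1), g t ω (ω (t + 1))) ^ 2 =
        (∑ t ∈ Finset.range n, g t ω (ω (t + 1))) ^ 2 +
        (2 * ((∑ t ∈ Finset.range n, g t ω (ω (t + 1))) * g n ω (ω (n + 1))) +
        g n ω (ω (n + 1)) ^ 2) := fun ω => by
      rw [Finset.sum_range_succ]
      ring
    have i23 : Integrable (fun ω => 2 * ((∑ t ∈ Finset.range n, g t ω (ω (t + 1))) *
        g n ω (ω (n + 1))) + g n ω (ω (n + 1)) ^ 2) μ := (i2.const_mul 2).add i3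
    rw [integral_congr_ae (ae_of_all _ e1)]
    simp only [Finset.sum_range_succ _ n, mul_add (C ^ 2)]
    rw [integral_add i1 i23, integral_add (i2.const_mul 2) i3,
      integral_const_mul, hcross, integral_add i4 i5]
    have := integral_mono i3 i5 fun ω => by
      rw [← mul_pow, ← sq_abs]
      exact pow_le_pow_left₀ (abs_nonneg _) (hgk n ω _) 2
    linarith

theorem ae_tendsto_sum_increments_of_bounded (x : S) (p : ℕ → S → ProbabilityMeasure S)
    {g : ℕ → (ℕ → S) → S → ℝ} {k : ℕ → (ℕ → S) → ℝ} {C N : ℝ}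
    (hg : ∀ t y, DependsOn (fun ω => g t ω y) (Set.Iic t))
    (hk : ∀ t, DependsOn (k t) (Set.Iic t))
    (h0 : ∀ t ω, ∫ y, g t ω y ∂(p t (ω t) : Measure S) = 0)
    (hgk : ∀ t ω y, |g t ω y| ≤ C * k t ω)
    (hN : ∀ n ω, ∑ t ∈ Finset.range n, k t ω ^ 2 ≤ N) :
    ∀ᵐ ω ∂(pathMeasure x p : Measure (ℕ → S)),
      ∃ L, Tendsto (fun n => ∑ t ∈ Finset.range n, g t ω (ω (t + 1))) atTop (𝓝 L) := by
  set μ : Measure (ℕ → S) := (pathMeasure x p : Measure (ℕ → S)) with hμ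
  let M : ℕ → (ℕ → S) → ℝ := fun n ω => ∑ t ∈ Finset.range n, g t ω (ω (t + 1))
  have hM : ∀ n, DependsOn (M n) (Set.Iic n) := dependsOn_sum_eval_succ hg
  have hint : ∀ n, Integrable (M n) μ := fun n => integrable_of_dependsOn (hM n)
  have hsub : Submartingale M (Filtration.piLE (X := fun _ : ℕ => S)) μ := by
    refine submartingale_of_setIntegral_le_succ
      (fun n => (measurable_piLE_of_dependsOn (hM n)).stronglyMeasurable) hint fun i s hs => ?_
    have hs' : MeasurableSet s := (Filtration.piLE.le i) s hs
    have hφ : DependsOn (s.indicator (fun _ => (1 : ℝ))) (Set.Iic i) :=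
      StronglyMeasurable.dependsOn_of_piLE
        ((measurable_const.indicator hs).stronglyMeasurable)
    have h1 := integral_mul_increment_eq_zero x p (hg i) (h0 i) hφ
    have h2 : ∀ n, ∫ ω in s, M n ω ∂μ = ∫ ω, s.indicator (fun _ => (1 : ℝ)) ω * M n ω ∂μ :=
      fun n => by
        rw [← integral_indicator hs']
        congr 1 with ω
        by_cases h : ω ∈ s <;> simp [h]
    have h3 : ∀ ω, s.indicator (fun _ => (1 : ℝ)) ω * M (i + 1) ω =
        s.indicator (fun _ => (1 : ℝ)) ω * M i ω +
        s.indicator (fun _ => (1 : ℝ)) ω * g i ω (ω (i + 1)) := fun ω => by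
      simp only [M, Finset.sum_range_succ, mul_add]
    have hb : Integrable (fun ω => s.indicator (fun _ => (1 : ℝ)) ω * M i ω) μ :=
      integrable_of_dependsOn (t := i) fun ω ω' h => congrArg₂ (· * ·) (hφ h) (hM i h)
    have hc : Integrable (fun ω => s.indicator (fun _ => (1 : ℝ)) ω * M (i + 1) ω) μ :=
      integrable_of_dependsOn (t := i + 1) fun ω ω' h => congrArg₂ (· * ·)
        (hφ fun j hj => h j (le_trans hj (Nat.le_succ i))) (hM (i + 1) h)
    have hd : Integrable (fun ω => s.indicator (fun _ => (1 : ℝ)) ω * g i ω (ω (i + 1))) μ := by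
      refine (hc.sub hb).congr (.of_forall fun ω => ?_)
      simp only [Pi.sub_apply, h3, add_sub_cancel_left]
    rw [h2, h2, funext h3, integral_add hb hd, h1, add_zero]
  have hbdd : ∀ n, eLpNorm (M n) 1 μ ≤ ((1 + C ^ 2 * N).toNNReal : ℝ≥0∞) := by
    intro n
    rw [eLpNorm_one_eq_lintegral_enorm, ← ofReal_integral_norm_eq_lintegral_enorm (hint n)]
    refine ENNReal.ofReal_le_ofReal ?_
    have hM2 : Integrable (fun ω => M n ω ^ 2) μ :=
      integrable_of_dependsOn (t := n) fun ω ω' h => congrArg (· ^ 2) (hM n h)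
    have h1 : ∫ ω, ‖M n ω‖ ∂μ ≤ ∫ ω, (1 + M n ω ^ 2) ∂μ :=
      integral_mono (hint n).norm ((integrable_const 1).add hM2) fun ω => by
        change |M n ω| ≤ 1 + M n ω ^ 2
        rw [← sq_abs]
        nlinarith [sq_nonneg (|M n ω| - 1), abs_nonneg (M n ω)]
    rw [integral_add (integrable_const 1) hM2] at h1
    have h2 := integral_sq_sum_increments_le x p hg hk h0 hgk n
    have hK : DependsOn (fun ω => ∑ t ∈ Finset.range n, k t ω ^ 2) (Set.Iic n) := fun ω ω' h =>
      Finset.sum_congr rfl fun t ht => by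
        rw [hk t fun i hi => h i (le_trans hi (Finset.mem_range.1 ht).le)]
    have h3 : ∫ ω, C ^ 2 * ∑ t ∈ Finset.range n, k t ω ^ 2 ∂μ ≤ ∫ ω, C ^ 2 * N ∂μ :=
      integral_mono ((integrable_of_dependsOn hK).const_mul _) (integrable_const _) fun ω =>
        mul_le_mul_of_nonneg_left (hN n ω) (sq_nonneg C)
    simp only [integral_const, probReal_univ, one_smul] at h1 h3
    exact h1.trans (by linarith)
  filter_upwards [hsub.ae_tendsto_limitProcess hbdd] with ω hω
  exact ⟨_, hω⟩

/-- Sums of centred increments converge almost surely if their sizes are almost surely square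
summable: the increments are switched off when the sum of squares exceeds a level `N`, and every
path with summable squares is unaffected for large `N`. -/
theorem ae_tendsto_sum_increments (x : S) (p : ℕ → S → ProbabilityMeasure S)
    {g : ℕ → (ℕ → S) → S → ℝ} {k : ℕ → (ℕ → S) → ℝ} {C : ℝ}
    (hg : ∀ t y, DependsOn (fun ω => g t ω y) (Set.Iic t))
    (hk : ∀ t, DependsOn (k t) (Set.Iic t))
    (h0 : ∀ t ω, ∫ y, g t ω y ∂(p t (ω t) : Measure S) = 0)
    (hgk : ∀ t ω y, |g t ω y| ≤ C * k t ω)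
    (hsum : ∀ᵐ ω ∂(pathMeasure x p : Measure (ℕ → S)), Summable fun t => k t ω ^ 2) :
    ∀ᵐ ω ∂(pathMeasure x p : Measure (ℕ → S)),
      ∃ L, Tendsto (fun n => ∑ t ∈ Finset.range n, g t ω (ω (t + 1))) atTop (𝓝 L) := by
  classical
  let χ : ℕ → ℕ → (ℕ → S) → ℝ := fun N t ω =>
    if ∑ s ∈ Finset.range (t + 1), k s ω ^ 2 ≤ N then 1 else 0
  have hχ : ∀ N t, DependsOn (χ N t) (Set.Iic t) := fun N t ω ω' h => by
    have : ∑ s ∈ Finset.range (t + 1), k s ω ^ 2 = ∑ s ∈ Finset.range (t + 1), k s ω' ^ 2 :=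
      Finset.sum_congr rfl fun s hs => by
        rw [hk s fun i hi => h i (le_trans hi (Nat.lt_succ_iff.1 (Finset.mem_range.1 hs)))]
    simp only [χ, this]
  have hχ0 : ∀ N t ω, 0 ≤ χ N t ω := fun N t ω => by
    simp only [χ]
    split_ifs <;> norm_num
  have key : ∀ N : ℕ, ∀ᵐ ω ∂(pathMeasure x p : Measure (ℕ → S)),
      ∃ L, Tendsto (fun n => ∑ t ∈ Finset.range n, χ N t ω * g t ω (ω (t + 1))) atTop (𝓝 L) := by
    intro N
    refine ae_tendsto_sum_increments_of_bounded x p (g := fun t ω y => χ N t ω * g t ω y)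
      (k := fun t ω => χ N t ω * k t ω) (C := C) (N := N) (fun t y ω ω' h => ?_)
      (fun t ω ω' h => ?_) (fun t ω => ?_) (fun t ω y => ?_) (fun n ω => ?_)
    · exact congrArg₂ (· * ·) (hχ N t h) (hg t y h)
    · exact congrArg₂ (· * ·) (hχ N t h) (hk t h)
    · rw [integral_const_mul, h0, mul_zero]
    · rw [abs_mul, abs_of_nonneg (hχ0 N t ω), mul_left_comm]
      exact mul_le_mul_of_nonneg_left (hgk t ω y) (hχ0 N t ω)
    · induction n with
      | zero => simp
      | succ n ih =>
        by_cases h : ∑ s ∈ Finset.range (n + 1), k s ω ^ 2 ≤ N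
        · refine le_trans (Finset.sum_le_sum fun t _ => ?_) h
          simp only [χ]
          split_ifs
          · simp
          · simpa using sq_nonneg (k t ω)
        · rw [Finset.sum_range_succ]
          simpa [χ, h] using ih
  filter_upwards [ae_all_iff.2 key, hsum] with ω hω hs
  obtain ⟨N, hN⟩ := exists_nat_ge (∑' t, k t ω ^ 2)
  obtain ⟨L, hL⟩ := hω N
  refine ⟨L, hL.congr fun n => Finset.sum_congr rfl fun t _ => ?_⟩
  have : ∑ s ∈ Finset.range (t + 1), k s ω ^ 2 ≤ N :=
    (hs.sum_le_tsum _ fun _ _ => sq_nonneg _).trans hN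
  simp [χ, this]

end NoiseConvergence

/-! ### Contractive recursions with convergent noise -/

section Deterministic

/-- Summation by parts: if the partial sums of `ξ` after time `n` stay below `δ`, then weighting
with a nonnegative monotone sequence `B` multiplies this bound by at most `2 * B t`. -/
theorem abs_sum_Ico_mul_le_of_monotone {B ξ : ℕ → ℝ} (hB : Monotone B) (hB0 : ∀ t, 0 ≤ B t)
    {n : ℕ} {δ : ℝ} (hξ : ∀ t, n ≤ t → |∑ s ∈ Finset.Ico n t, ξ s| ≤ δ) {t : ℕ} (ht : n ≤ t) :
    |∑ s ∈ Finset.Ico n t, B s * ξ s| ≤ 2 * δ * B t := by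
  have hδ : 0 ≤ δ := (abs_nonneg _).trans (hξ n le_rfl)
  have key : |B t * ∑ s ∈ Finset.Ico n t, ξ s - ∑ s ∈ Finset.Ico n t, B s * ξ s| ≤
      δ * (B t - B n) := by
    induction t, ht using Nat.le_induction with
    | base => simp
    | succ t ht ih =>
      have e : B (t + 1) * ∑ s ∈ Finset.Ico n (t + 1), ξ s
          - ∑ s ∈ Finset.Ico n (t + 1), B s * ξ s =
          (B t * ∑ s ∈ Finset.Ico n t, ξ s - ∑ s ∈ Finset.Ico n t, B s * ξ s)
          + (B (t + 1) - B t) * ∑ s ∈ Finset.Ico n (t + 1), ξ s := by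
        rw [Finset.sum_Ico_succ_top ht, Finset.sum_Ico_succ_top ht]
        ring
      have hd : 0 ≤ B (t + 1) - B t := sub_nonneg.2 (hB (Nat.le_succ t))
      have h1 : |(B (t + 1) - B t) * ∑ s ∈ Finset.Ico n (t + 1), ξ s| ≤ (B (t + 1) - B t) * δ := by
        rw [abs_mul, abs_of_nonneg hd]
        exact mul_le_mul_of_nonneg_left (hξ _ (by omega)) hd
      rw [e]
      refine (abs_add_le _ _).trans ?_
      linarith
  have h1 : |B t * ∑ s ∈ Finset.Ico n t, ξ s| ≤ B t * δ := by
    rw [abs_mul, abs_of_nonneg (hB0 t)]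
    exact mul_le_mul_of_nonneg_left (hξ t ht) (hB0 t)
  have h2 := abs_sub_abs_le_abs_sub (∑ s ∈ Finset.Ico n t, B s * ξ s)
    (B t * ∑ s ∈ Finset.Ico n t, ξ s)
  rw [abs_sub_comm] at h2
  have h3 := mul_nonneg hδ (hB0 n)
  linarith

theorem exists_forall_abs_sum_Ico_le {ξ : ℕ → ℝ} {L : ℝ}
    (h : Tendsto (fun n => ∑ t ∈ Finset.range n, ξ t) atTop (𝓝 L)) {δ : ℝ} (hδ : 0 < δ) :
    ∀ᶠ n in atTop, ∀ t, n ≤ t → |∑ s ∈ Finset.Ico n t, ξ s| ≤ δ := by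
  obtain ⟨N, hN⟩ := Metric.cauchySeq_iff.1 h.cauchySeq δ hδ
  filter_upwards [eventually_ge_atTop N] with n hn t ht
  rw [Finset.sum_Ico_eq_sub _ ht, ← Real.dist_eq]
  exact (hN t (hn.trans ht) n hn).le

/-- Averaging towards `c` with rates of divergent sum pulls `y` below any level above `c`: the
excess over `c` after time `n` decays like `exp (-∑ γ)`. -/
theorem eventually_le_of_averaging {y γ : ℕ → ℝ} {c : ℝ} {n : ℕ} (hγ1 : ∀ t, γ t ≤ 1)
    (hγ : Tendsto (fun n => ∑ t ∈ Finset.range n, γ t) atTop atTop)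
    (hy : ∀ t, n ≤ t → y (t + 1) ≤ (1 - γ t) * y t + γ t * c) {κ : ℝ} (hκ : 0 < κ) :
    ∀ᶠ t in atTop, y t ≤ c + κ := by
  have key : ∀ t, n ≤ t → y t - c ≤
      Real.exp (-(∑ s ∈ Finset.range t, γ s - ∑ s ∈ Finset.range n, γ s)) * |y n - c| := by
    intro t ht
    induction t, ht using Nat.le_induction with
    | base => simpa using le_abs_self (y n - c)
    | succ t ht ih =>
      have h1 : y (t + 1) - c ≤ (1 - γ t) * (y t - c) := by linarith [hy t ht]
      have h2 := mul_le_mul_of_nonneg_left ih (sub_nonneg.2 (hγ1 t))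
      have h3 : 1 - γ t ≤ Real.exp (-γ t) := Real.one_sub_le_exp_neg _
      have h4 := mul_le_mul_of_nonneg_right h3 (mul_nonneg (Real.exp_nonneg
        (-(∑ s ∈ Finset.range t, γ s - ∑ s ∈ Finset.range n, γ s))) (abs_nonneg (y n - c)))
      refine (h1.trans (h2.trans h4)).trans_eq ?_
      rw [← mul_assoc, ← Real.exp_add, Finset.sum_range_succ]
      congr 2
      ring
  have hlim : Tendsto (fun t => Real.exp (-(∑ s ∈ Finset.range t, γ s
      - ∑ s ∈ Finset.range n, γ s)) * |y n - c|) atTop (𝓝 0) := by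
    have h1 : Tendsto (fun t => ∑ s ∈ Finset.range t, γ s - ∑ s ∈ Finset.range n, γ s)
        atTop atTop := tendsto_atTop_add_const_right _ _ hγ
    simpa using (Real.tendsto_exp_neg_atTop_nhds_zero.comp h1).mul_const |y n - c|
  filter_upwards [hlim.eventually_le_const hκ, eventually_ge_atTop n] with t h1 h2
  linarith [key t h2]

variable {ι : Type*} [Fintype ι]

/-- A path of a stochastic approximation recursion with an `α`-contracting drift `G`. The noise at
time `t` is `B t * ξ t`, where `B` is the running maximum of the errors `‖Δ t‖` (and of a positive
constant), and the normalized noise `ξ` has convergent partial sums. -/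
structure IsContractiveRecursion (α : ℝ) (Δ G γ ξ : ℕ → ι → ℝ) (B : ℕ → ℝ) : Prop where
  step : ∀ t i, Δ (t + 1) i = (1 - γ t i) * Δ t i + γ t i * G t i + B t * ξ t i
  rate_nonneg : ∀ t i, 0 ≤ γ t i
  rate_le_one : ∀ t i, γ t i ≤ 1
  drift : ∀ t i, |G t i| ≤ α * ‖Δ t‖
  bound_zero : 0 < B 0
  norm_le_zero : ‖Δ 0‖ ≤ B 0
  bound_succ : ∀ t, B (t + 1) = max (B t) ‖Δ (t + 1)‖
  noise : ∀ i, ∃ L, Tendsto (fun n => ∑ t ∈ Finset.range n, ξ t i) atTop (𝓝 L)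
  rate_sum : ∀ i, Tendsto (fun n => ∑ t ∈ Finset.range n, γ t i) atTop atTop

namespace IsContractiveRecursion

variable {α : ℝ} {Δ G γ ξ : ℕ → ι → ℝ} {B : ℕ → ℝ}

theorem monotone (h : IsContractiveRecursion α Δ G γ ξ B) : Monotone B :=
  monotone_nat_of_le_succ fun t => by rw [h.bound_succ]; exact le_max_left _ _

theorem pos (h : IsContractiveRecursion α Δ G γ ξ B) (t : ℕ) : 0 < B t :=
  h.bound_zero.trans_le (h.monotone (Nat.zero_le t))

theorem norm_le (h : IsContractiveRecursion α Δ G γ ξ B) (t : ℕ) : ‖Δ t‖ ≤ B t := by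
  cases t with
  | zero => exact h.norm_le_zero
  | succ t => rw [h.bound_succ]; exact le_max_right _ _

theorem eventually_noise_le (h : IsContractiveRecursion α Δ G γ ξ B) {δ : ℝ} (hδ : 0 < δ) :
    ∀ᶠ n in atTop, ∀ i t, n ≤ t → |∑ s ∈ Finset.Ico n t, B s * ξ s i| ≤ 2 * δ * B t := by
  refine eventually_all.2 fun i => ?_
  obtain ⟨L, hL⟩ := h.noise i
  filter_upwards [exists_forall_abs_sum_Ico_le hL hδ] with n hn t ht
  exact abs_sum_Ico_mul_le_of_monotone h.monotone (fun t => (h.pos t).le) hn ht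

/-- Subtracting the accumulated noise leaves an averaging recursion. -/
theorem abs_sub_noise_succ_le (h : IsContractiveRecursion α Δ G γ ξ B) {n t : ℕ} (ht : n ≤ t)
    (i : ι) {c : ℝ} (hc : |G t i| + |∑ s ∈ Finset.Ico n t, B s * ξ s i| ≤ c) :
    |Δ (t + 1) i - ∑ s ∈ Finset.Ico n (t + 1), B s * ξ s i| ≤
      (1 - γ t i) * |Δ t i - ∑ s ∈ Finset.Ico n t, B s * ξ s i| + γ t i * c := by
  have e : Δ (t + 1) i - ∑ s ∈ Finset.Ico n (t + 1), B s * ξ s i =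
      (1 - γ t i) * (Δ t i - ∑ s ∈ Finset.Ico n t, B s * ξ s i)
      + γ t i * (G t i - ∑ s ∈ Finset.Ico n t, B s * ξ s i) := by
    rw [Finset.sum_Ico_succ_top ht, h.step]
    ring
  rw [e]
  refine (abs_add_le _ _).trans ?_
  rw [abs_mul, abs_mul, abs_of_nonneg (h.rate_nonneg t i),
    abs_of_nonneg (sub_nonneg.2 (h.rate_le_one t i))]
  have := mul_le_mul_of_nonneg_left ((abs_sub _ _).trans hc) (h.rate_nonneg t i)
  linarith

/-- The running maximum is bounded. After a late time `n`, each error is at most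
`max (B n) ((α + 2 * δ) * B t) + 2 * δ * B t`; at a time `t` where a new maximum `B t = ‖Δ t‖` is
reached this gives `B t ≤ B n / (1 - 2 * δ)`. -/
theorem exists_bound (h : IsContractiveRecursion α Δ G γ ξ B) (hα0 : 0 ≤ α) (hα1 : α < 1) :
    ∃ K, ∀ t, B t ≤ K := by
  -- with this `δ` both `α + 4 * δ < 1` and `2 * δ < 1`
  set δ := (1 - α) / 8 with hδ
  have hδ0 : 0 < δ := by rw [hδ]; linarith
  have hδ1 : α + 4 * δ < 1 := by rw [hδ]; linarith
  obtain ⟨n, hn⟩ := (h.eventually_noise_le hδ0).exists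
  have hY : ∀ i t, n ≤ t → |Δ t i - ∑ s ∈ Finset.Ico n t, B s * ξ s i| ≤
      max (B n) ((α + 2 * δ) * B t) := by
    intro i t ht
    induction t, ht using Nat.le_induction with
    | base => simpa using Or.inl ((norm_le_pi_norm (Δ n) i).trans (h.norm_le n))
    | succ t ht ih =>
      have h1 : |G t i| + |∑ s ∈ Finset.Ico n t, B s * ξ s i| ≤ (α + 2 * δ) * B t := by
        have := mul_le_mul_of_nonneg_left (h.norm_le t) hα0
        linarith [h.drift t i, hn i t ht]
      have h2 : (α + 2 * δ) * B t ≤ (α + 2 * δ) * B (t + 1) :=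
        mul_le_mul_of_nonneg_left (h.monotone (Nat.le_succ t)) (by linarith)
      have h3 := h.abs_sub_noise_succ_le ht i (h1.trans (le_max_right (B n) _))
      have h4 := mul_le_mul_of_nonneg_left ih (sub_nonneg.2 (h.rate_le_one t i))
      have h5 : max (B n) ((α + 2 * δ) * B t) ≤ max (B n) ((α + 2 * δ) * B (t + 1)) :=
        max_le_max le_rfl h2
      linarith
  have hΔ : ∀ t, n ≤ t → ‖Δ t‖ ≤ max (B n) ((α + 2 * δ) * B t) + 2 * δ * B t := by
    intro t ht
    refine (pi_norm_le_iff_of_nonneg ?_).2 fun i => ?_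
    · have := h.pos t
      have := h.pos n
      exact add_nonneg ((h.pos n).le.trans (le_max_left _ _)) (by positivity)
    · have h1 := abs_sub_abs_le_abs_sub (Δ t i) (∑ s ∈ Finset.Ico n t, B s * ξ s i)
      rw [Real.norm_eq_abs]
      linarith [hY i t ht, hn i t ht]
  have hBn : B n ≤ B n / (1 - 2 * δ) := by
    rw [le_div_iff₀ (by linarith)]
    nlinarith [h.pos n]
  have hB : ∀ t, n ≤ t → B t ≤ B n / (1 - 2 * δ) := by
    intro t ht
    induction t, ht using Nat.le_induction with
    | base => exact hBn
    | succ t ht ih =>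
      rcases le_total (‖Δ (t + 1)‖) (B t) with h1 | h1
      · rw [h.bound_succ, max_eq_left h1]
        exact ih
      · have e : B (t + 1) = ‖Δ (t + 1)‖ := by rw [h.bound_succ, max_eq_right h1]
        have h2 := hΔ (t + 1) (by omega)
        rw [← e] at h2
        have hp := h.pos (t + 1)
        rw [le_div_iff₀ (by linarith)]
        rcases max_cases (B n) ((α + 2 * δ) * B (t + 1)) with ⟨h3, _⟩ | ⟨h3, _⟩ <;> rw [h3] at h2
        · linarith
        · nlinarith
  refine ⟨B n / (1 - 2 * δ), fun t => ?_⟩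
  rcases le_total n t with ht | ht
  · exact hB t ht
  · exact (h.monotone ht).trans hBn

theorem eventually_norm_le_mul_add (h : IsContractiveRecursion α Δ G γ ξ B) (hα0 : 0 ≤ α)
    (hα1 : α < 1) {D η : ℝ} (hη : 0 < η) (hD0 : 0 ≤ D) (hD : ∀ᶠ t in atTop, ‖Δ t‖ ≤ D) :
    ∀ᶠ t in atTop, ‖Δ t‖ ≤ α * D + η := by
  obtain ⟨K, hK⟩ := h.exists_bound hα0 hα1
  have hK0 : 0 < K := (h.pos 0).trans_le (hK 0)
  obtain ⟨n, hn, hnD⟩ := ((h.eventually_noise_le (δ := η / (6 * K)) (by positivity)).and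
    (eventually_forall_ge_atTop.2 hD)).exists
  have hn' : ∀ i t, n ≤ t → |∑ s ∈ Finset.Ico n t, B s * ξ s i| ≤ η / 3 := fun i t ht =>
    (hn i t ht).trans <| by
      have := mul_le_mul_of_nonneg_left (hK t) (show 0 ≤ 2 * (η / (6 * K)) by positivity)
      refine this.trans_eq ?_
      field_simp
      norm_num
  have hev : ∀ᶠ t in atTop, ∀ i, |Δ t i - ∑ s ∈ Finset.Ico n t, B s * ξ s i| ≤
      (α * D + η / 3) + η / 3 := by
    refine eventually_all.2 fun i => eventually_le_of_averaging (n := n)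
      (fun t => h.rate_le_one t i) (h.rate_sum i) (fun t ht => ?_) (by positivity)
    refine h.abs_sub_noise_succ_le ht i (add_le_add ((h.drift t i).trans ?_) (hn' i t ht))
    exact mul_le_mul_of_nonneg_left (hnD t ht) hα0
  filter_upwards [hev, eventually_ge_atTop n] with t h1 h2
  refine (pi_norm_le_iff_of_nonneg (by positivity)).2 fun i => ?_
  have h3 := abs_sub_abs_le_abs_sub (Δ t i) (∑ s ∈ Finset.Ico n t, B s * ξ s i)
  rw [Real.norm_eq_abs]
  linarith [h1 i, hn' i t h2]

theorem tendsto_norm_zero (h : IsContractiveRecursion α Δ G γ ξ B) (hα0 : 0 ≤ α) (hα1 : α < 1) :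
    Tendsto (fun t => ‖Δ t‖) atTop (𝓝 0) := by
  obtain ⟨K, hK⟩ := h.exists_bound hα0 hα1
  have hK0 : 0 < K := (h.pos 0).trans_le (hK 0)
  have h1α : 0 < 1 - α := by linarith
  have key : ∀ η : ℝ, 0 < η → ∀ k : ℕ, ∀ᶠ t in atTop, ‖Δ t‖ ≤ α ^ k * K + η / (1 - α) := by
    intro η hη k
    induction k with
    | zero =>
      refine .of_forall fun t => ((h.norm_le t).trans (hK t)).trans ?_
      have : 0 ≤ η / (1 - α) := by positivity
      linarith
    | succ k ih =>
      filter_upwards [h.eventually_norm_le_mul_add hα0 hα1 hη (by positivity) ih] with t ht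
      refine ht.trans_eq ?_
      field_simp
      ring
  refine (tendsto_order.2 ⟨fun a ha => .of_forall fun t => ha.trans_le (norm_nonneg _),
    fun e he => ?_⟩)
  have hlim : Tendsto (fun k : ℕ => α ^ k * K) atTop (𝓝 0) := by
    simpa using (tendsto_pow_atTop_nhds_zero_of_lt_one hα0 hα1).mul_const K
  obtain ⟨k, hk⟩ := (hlim.eventually_lt_const (half_pos he)).exists
  filter_upwards [key (e / 2 * (1 - α)) (by positivity) k] with t ht
  rw [mul_div_cancel_right₀ _ h1α.ne'] at ht
  linarith

end IsContractiveRecursion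

end Deterministic

/-! ### Convergence of the iterates -/

section Convergence

/-- The running maximum of `1` and the first terms of a sequence. -/
noncomputable def runningMax (u : ℕ → ℝ) : ℕ → ℝ
  | 0 => max 1 (u 0)
  | t + 1 => max (runningMax u t) (u (t + 1))

theorem one_le_runningMax (u : ℕ → ℝ) (t : ℕ) : 1 ≤ runningMax u t := by
  induction t with
  | zero => exact le_max_left _ _
  | succ t ih => exact ih.trans (le_max_left _ _)

theorem le_runningMax (u : ℕ → ℝ) (t : ℕ) : u t ≤ runningMax u t := by
  cases t <;> exact le_max_right _ _

theorem runningMax_congr {u v : ℕ → ℝ} {t : ℕ} (h : ∀ s ≤ t, u s = v s) :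
    runningMax u t = runningMax v t := by
  induction t with
  | zero => simp only [runningMax, h 0 le_rfl]
  | succ t ih =>
    simp only [runningMax, ih fun s hs => h s (by omega), h (t + 1) le_rfl]

theorem sum_Icc_one_eq_sum_range (f : ℕ → ℝ) (n : ℕ) :
    ∑ t ∈ Finset.Icc 1 n, f t = ∑ t ∈ Finset.range n, f (t + 1) := by
  induction n with
  | zero => simp
  | succ n ih => rw [Finset.sum_Icc_succ_top (by omega), ih, Finset.sum_range_succ]

variable {S A : Type*}

theorem dependsOn_learningRate (γ : ℕ → ℝ) (a : ℕ → S → A) (t : ℕ) (x : S) (b : A) :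
    DependsOn (fun ω => learningRate γ a t ω x b) (Set.Iic t) := by
  intro ω ω' h
  have hv : visits a t ω x b = visits a t ω' x b := by
    classical
    unfold visits
    refine congrArg Finset.card (Finset.filter_congr fun s hs => ?_)
    rw [h s (Nat.lt_succ_iff.1 (Finset.mem_range.1 hs))]
  have ht : (ω t, a t (ω t)) = (ω' t, a t (ω' t)) := by rw [h t (le_refl t)]
  change learningRate γ a t ω x b = learningRate γ a t ω' x b
  unfold learningRate
  rw [hv, ht]

theorem learningRate_mem_Icc {γ : ℕ → ℝ} (hγ : ∀ n, γ n ∈ Set.Icc (0 : ℝ) 1) (a : ℕ → S → A)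
    (t : ℕ) (ω : ℕ → S) (x : S) (b : A) : learningRate γ a t ω x b ∈ Set.Icc (0 : ℝ) 1 := by
  unfold learningRate
  split_ifs
  · exact hγ _
  · simp

theorem learningRate_eq_zero_or (γ : ℕ → ℝ) (a : ℕ → S → A) (t : ℕ) (ω : ℕ → S) (x : S) (b : A) :
    learningRate γ a t ω x b = 0 ∨ (ω t = x ∧ a t (ω t) = b) := by
  unfold learningRate
  split_ifs with h
  · exact Or.inr (Prod.mk.inj h)
  · exact Or.inl rfl

theorem dependsOn_qIterate {α ε : ℝ} {q : ℕ} {r : S → A → S → ℝ} {c : S → S → ℝ≥0∞} {γ : ℕ → ℝ}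
    {a : ℕ → S → A} {Q₀ : S → A → ℝ} {lam : ℕ → (ℕ → S) → ℝ}
    (hlam : ∀ t, DependsOn (lam t) (Set.Iic t)) (t : ℕ) :
    DependsOn (qIterate α ε q r c γ a Q₀ lam t) (Set.Iic t) := by
  induction t with
  | zero => exact fun _ _ _ => rfl
  | succ t ih =>
    intro ω ω' h
    have h' : ∀ i ∈ Set.Iic t, ω i = ω' i := fun i hi => h i (le_trans hi (Nat.le_succ t))
    funext x b
    have hr := dependsOn_learningRate γ a t x b h'
    simp only at hr
    simp only [qIterate, ih h', hlam t h', h (t + 1) (le_refl (t + 1))]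
    rw [hr]

section Bounds

variable [Finite A] [Nonempty A]

theorem abs_target_sub_target_le {α : ℝ} (hα0 : 0 ≤ α) (r : S → A → S → ℝ) {Q Q' : S → A → ℝ}
    {δ : ℝ} (h : ∀ y b, |Q y b - Q' y b| ≤ δ) (x : S) (b : A) (y : S) :
    |target α r Q x b y - target α r Q' x b y| ≤ α * δ := by
  rw [target, target, add_sub_add_left_eq_sub, ← mul_sub, abs_mul, abs_of_nonneg hα0]
  exact mul_le_mul_of_nonneg_left (abs_ciSup_sub_ciSup_le (h y)) hα0

theorem abs_target_le {α : ℝ} (hα0 : 0 ≤ α) {r : S → A → S → ℝ} {Q : S → A → ℝ} {R M : ℝ}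
    (hr : ∀ x b y, |r x b y| ≤ R) (h : ∀ y b, |Q y b| ≤ M) (x : S) (b : A) (y : S) :
    |target α r Q x b y| ≤ R + α * M := by
  have h1 := abs_ciSup_sub_ciSup_le (f := Q y) (g := fun _ => (0 : ℝ)) (δ := M) (by simpa using h y)
  rw [ciSup_const, sub_zero] at h1
  refine (abs_add_le _ _).trans (add_le_add (hr x b y) ?_)
  rw [abs_mul, abs_of_nonneg hα0]
  exact mul_le_mul_of_nonneg_left h1 hα0

end Bounds

variable [Fintype S] [MeasurableSpace S] [MeasurableSingletonClass S]

/-- An optimal multiplier satisfies `e * l ≤ 2 * M`, since `l = 0` already yields at least `-M`;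
hence the samples are bounded by a multiple of the bound on the target. -/
theorem abs_transform_sub_le {c : S → S → ℝ≥0∞} (hc : ∀ y, c y y = 0) {e : ℝ} (he : 0 ≤ e)
    (ν : Measure S) [IsProbabilityMeasure ν] {f : S → ℝ} {M : ℝ} (hf : ∀ y, |f y| ≤ M) {l : ℝ}
    (hl : 0 ≤ l)
    (hmax : IsMaxOn (fun l => ∫ y, (-lambdaCTransform c l (fun z => -f z) y - e * l) ∂ν)
      (Set.Ici 0) l) (y : S) :
    |-lambdaCTransform c l (fun z => -f z) y - e * l| ≤ 3 * M := by
  have hup : ∀ y, -lambdaCTransform c l (fun z => -f z) y ≤ M := fun y => by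
    have := neg_lambdaCTransform_le (c := c) l f (y := y) (z := y) (by simp [hc])
    simp only [hc, ENNReal.toReal_zero, mul_zero, add_zero] at this
    exact this.trans (abs_le.1 (hf y)).2
  have hlow : ∀ s, 0 ≤ s → ∀ y, -M ≤ -lambdaCTransform c s (fun z => -f z) y := fun s hs y => by
    obtain ⟨z, -, hz⟩ := exists_neg_lambdaCTransform_eq (c := c) s f (hc y)
    rw [hz]
    have := mul_nonneg hs (c y z).toReal_nonneg
    linarith [(abs_le.1 (hf z)).1]
  have h0 : -M ≤ ∫ y, (-lambdaCTransform c 0 (fun z => -f z) y - e * 0) ∂ν :=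
    le_integral_of_forall_le ν fun y => by simpa using hlow 0 le_rfl y
  have h1 : ∫ y, (-lambdaCTransform c l (fun z => -f z) y - e * l) ∂ν ≤ M - e * l :=
    integral_le_of_forall_le ν fun y => by linarith [hup y]
  have h2 : -M ≤ M - e * l := h0.trans ((hmax (Set.mem_Ici.2 le_rfl)).trans h1)
  have h3 := mul_nonneg he hl
  rw [abs_le]
  constructor
  · linarith [hlow l hl y]
  · linarith [hup y]

variable [Fintype A] [Nonempty A]

/-- Robust `Q`-learning converges to the optimal `Q`-function whenever the dual problem solved by
the multipliers represents the robust expectation over the ambiguity sets. -/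
theorem ae_tendsto_qIterate {α ε : ℝ} (hα0 : 0 < α) (hα1 : α < 1) (hε : 0 < ε) {q : ℕ}
    {γ : ℕ → ℝ} (hγ : ∀ n, γ n ∈ Set.Icc (0 : ℝ) 1) (r : S → A → S → ℝ) {c : S → S → ℝ≥0∞}
    (hc : ∀ y, c y y = 0) {Phat : S → A → ProbabilityMeasure S}
    {P : S → A → Set (ProbabilityMeasure S)} (hP : ∀ x b, (P x b).Nonempty)
    (hdual : ∀ x b (f : S → ℝ) (l : ℝ), 0 ≤ l →
      IsMaxOn (fun l => ∫ y, (-lambdaCTransform c l (fun z => -f z) y - ε ^ q * l)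
        ∂(Phat x b : Measure S)) (Set.Ici 0) l →
      ∫ y, (-lambdaCTransform c l (fun z => -f z) y - ε ^ q * l) ∂(Phat x b : Measure S) =
        infExp (P x b) f)
    {x₀ : S} {a : ℕ → S → A} {Q₀ : S → A → ℝ} {lam : ℕ → (ℕ → S) → ℝ}
    (hstep : StepSizeCondition (controlledMeasure Phat x₀ a) γ a)
    (hlam : IsMultiplierChoice α ε q r c Phat γ a Q₀ lam) (x : S) (b : A) :
    ∀ᵐ ω ∂(controlledMeasure Phat x₀ a : Measure (ℕ → S)),
      Tendsto (fun t => qIterate α ε q r c γ a Q₀ lam t ω x b) atTop (𝓝 (optimalQ α r P x b)) := by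
  have hlamdep : ∀ t, DependsOn (lam t) (Set.Iic t) := fun t =>
    StronglyMeasurable.dependsOn_of_piLE (hlam.1 t).stronglyMeasurable
  set Qs := optimalQ α r P with hQs
  let Q : ℕ → (ℕ → S) → S → A → ℝ := qIterate α ε q r c γ a Q₀ lam
  let Δ : ℕ → (ℕ → S) → S × A → ℝ := fun t ω i => Q t ω i.1 i.2 - Qs i.1 i.2
  let B : ℕ → (ℕ → S) → ℝ := fun t ω => runningMax (fun s => ‖Δ s ω‖) t
  -- the sample `h` and its mean under the reference kernel
  let h : ℕ → (ℕ → S) → S × A → S → ℝ := fun t ω i y =>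
    sampleTarget α ε q r c (Q t ω) i.1 i.2 (lam t ω) y
  let hm : ℕ → (ℕ → S) → S × A → ℝ := fun t ω i => ∫ y, h t ω i y ∂(Phat i.1 i.2 : Measure S)
  let k : ℕ → (ℕ → S) → S × A → ℝ := fun t ω i => learningRate γ a t ω i.1 i.2
  let g : S × A → ℕ → (ℕ → S) → S → ℝ := fun i t ω y =>
    k t ω i * (h t ω i y - hm t ω i) / B t ω
  have hQdep : ∀ t, DependsOn (Q t) (Set.Iic t) := dependsOn_qIterate hlamdep
  have hBdep : ∀ t, DependsOn (B t) (Set.Iic t) := fun t ω ω' h =>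
    runningMax_congr fun s hs => by
      simp only [Δ, hQdep s fun i hi => h i (le_trans hi hs)]
  have hkdep : ∀ i t, DependsOn (fun ω => k t ω i) (Set.Iic t) := fun i t =>
    dependsOn_learningRate γ a t i.1 i.2
  have hk01 : ∀ t ω i, k t ω i ∈ Set.Icc (0 : ℝ) 1 := fun t ω i =>
    learningRate_mem_Icc hγ a t ω i.1 i.2
  have hB1 : ∀ t ω, 1 ≤ B t ω := fun t ω => one_le_runningMax _ t
  have hB0 : ∀ t ω, 0 < B t ω := fun t ω => zero_lt_one.trans_le (hB1 t ω)
  have hgdep : ∀ i t y, DependsOn (fun ω => g i t ω y) (Set.Iic t) := fun i t y ω ω' hω => by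
    have h1 : k t ω i = k t ω' i := hkdep i t hω
    simp only [g, h, hm, h1, hBdep t hω, hQdep t hω, hlamdep t hω]
  have hg0 : ∀ i t ω, ∫ y, g i t ω y ∂(Phat (ω t) (a t (ω t)) : Measure S) = 0 := by
    intro i t ω
    rcases learningRate_eq_zero_or γ a t ω i.1 i.2 with h0 | ⟨h1, h2⟩
    · have h0' : k t ω i = 0 := h0
      simp [g, h0']
    · simp only [g, h2]
      rw [h1, integral_div, integral_const_mul, integral_sub .of_finite .of_finite]
      simp [hm]
  -- the bound on the normalized noise
  obtain ⟨R, hR0, hR⟩ := exists_abs_le_reward r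
  obtain ⟨M, hM⟩ := (Set.finite_range fun i : S × A => |Qs i.1 i.2|).bddAbove
  have hM' : ∀ y b, |Qs y b| ≤ M := fun y b => hM ⟨(y, b), rfl⟩
  have hM0 : 0 ≤ M := (abs_nonneg _).trans (hM' x b)
  have hΔB : ∀ t ω, ‖Δ t ω‖ ≤ B t ω := fun t ω => le_runningMax (fun s => ‖Δ s ω‖) t
  have htarget : ∀ t ω x b y, |target α r (Q t ω) x b y| ≤ (R + M + 1) * B t ω := by
    intro t ω x b y
    have h1 := abs_target_le hα0.le hR (Q := Q t ω) (M := M + B t ω) (fun y b => by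
      have h2 : |Δ t ω (y, b)| ≤ B t ω := (norm_le_pi_norm (Δ t ω) (y, b)).trans (hΔB t ω)
      have h3 : Q t ω y b = Qs y b + Δ t ω (y, b) := by simp [Δ]
      rw [h3]
      exact (abs_add_le _ _).trans (add_le_add (hM' y b) h2)) x b y
    nlinarith [hB1 t ω, mul_nonneg hR0 (sub_nonneg.2 (hB1 t ω)),
      mul_nonneg hM0 (sub_nonneg.2 (hB1 t ω)), mul_nonneg (sub_nonneg.2 hα1.le)
        (add_nonneg hM0 (hB0 t ω).le)]
  have hgk : ∀ i t ω y, |g i t ω y| ≤ 6 * (R + M + 1) * k t ω i := by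
    intro i t ω y
    have hk0 := (hk01 t ω i).1
    rcases learningRate_eq_zero_or γ a t ω i.1 i.2 with h0 | ⟨h1, h2⟩
    · have h0' : k t ω i = 0 := h0
      simp [g, h0']
    · have hmax := (hlam.2 t ω).2
      rw [h2, h1] at hmax
      have hb : ∀ y, |h t ω i y| ≤ 3 * ((R + M + 1) * B t ω) := fun y =>
        abs_transform_sub_le hc (by positivity) (Phat i.1 i.2 : Measure S)
          (htarget t ω i.1 i.2) (hlam.2 t ω).1 hmax y
      have hmb : |hm t ω i| ≤ 3 * ((R + M + 1) * B t ω) := abs_le.2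
        ⟨le_integral_of_forall_le _ fun y => (abs_le.1 (hb y)).1,
          integral_le_of_forall_le _ fun y => (abs_le.1 (hb y)).2⟩
      have h3 := (abs_sub (h t ω i y) (hm t ω i)).trans (add_le_add (hb y) hmb)
      simp only [g]
      rw [abs_div, abs_mul, abs_of_nonneg hk0, abs_of_pos (hB0 t ω), div_le_iff₀ (hB0 t ω)]
      have := mul_le_mul_of_nonneg_left h3 hk0
      linarith
  have hae : ∀ᵐ ω ∂(controlledMeasure Phat x₀ a : Measure (ℕ → S)), ∀ i : S × A,
      (∃ L, Tendsto (fun n => ∑ t ∈ Finset.range n, g i t ω (ω (t + 1))) atTop (𝓝 L)) ∧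
      Tendsto (fun n => ∑ t ∈ Finset.range n, k t ω i) atTop atTop := by
    refine ae_all_iff.2 fun i => ?_
    have hsq : ∀ᵐ ω ∂(controlledMeasure Phat x₀ a : Measure (ℕ → S)),
        Summable fun t => k t ω i ^ 2 := by
      filter_upwards [hstep i.1 i.2] with ω hω
      exact (summable_nat_add_iff 1).1 hω.2
    filter_upwards [hstep i.1 i.2, ae_tendsto_sum_increments x₀ (fun t y => Phat y (a t y))
      (hgdep i) (hkdep i) (hg0 i) (hgk i) hsq] with ω h1 h2
    refine ⟨h2, ?_⟩
    rw [← tendsto_add_atTop_iff_nat 1]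
    simp_rw [Finset.sum_range_succ']
    refine tendsto_atTop_add_const_right _ _ (h1.1.congr fun n => ?_)
    exact sum_Icc_one_eq_sum_range _ n
  filter_upwards [hae] with ω hω
  have hrec : IsContractiveRecursion α (fun t => Δ t ω)
      (fun t i => infExp (P i.1 i.2) (target α r (Q t ω) i.1 i.2) - Qs i.1 i.2)
      (fun t => k t ω) (fun t i => g i t ω (ω (t + 1))) (fun t => B t ω) :=
    { step := fun t i => by
        have e : Δ (t + 1) ω i = Q t ω i.1 i.2 + k t ω i *
          (h t ω i (ω (t + 1)) - Q t ω i.1 i.2) - Qs i.1 i.2 := rfl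
        have e2 : B t ω * g i t ω (ω (t + 1)) =
            k t ω i * (h t ω i (ω (t + 1)) - hm t ω i) := by
          simp only [g]
          rw [mul_div_cancel₀ _ (hB0 t ω).ne']
        have e3 : k t ω i * hm t ω i =
            k t ω i * infExp (P i.1 i.2) (target α r (Q t ω) i.1 i.2) := by
          rcases learningRate_eq_zero_or γ a t ω i.1 i.2 with h0 | ⟨h1, h2⟩
          · have h0' : k t ω i = 0 := h0
            simp [h0']
          · have hmax := (hlam.2 t ω).2
            rw [h2, h1] at hmax
            rw [← hdual i.1 i.2 _ _ (hlam.2 t ω).1 hmax]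
            rfl
        rw [e, e2]
        simp only [Δ]
        linear_combination e3
      rate_nonneg := fun t i => (hk01 t ω i).1
      rate_le_one := fun t i => (hk01 t ω i).2
      drift := fun t i => by
        have hfix : Qs i.1 i.2 = infExp (P i.1 i.2) (target α r Qs i.1 i.2) :=
          optimalQ_eq_infExp hα0 hα1 r P hP i.1 i.2
        rw [hfix]
        exact abs_infExp_sub_infExp_le (hP i.1 i.2) fun y =>
          abs_target_sub_target_le hα0.le r
            (fun y b => norm_le_pi_norm (Δ t ω) (y, b)) i.1 i.2 y
      bound_zero := hB0 0 ω
      norm_le_zero := hΔB 0 ω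
      bound_succ := fun t => rfl
      noise := fun i => (hω i).1
      rate_sum := fun i => (hω i).2 }
  have hlim := hrec.tendsto_norm_zero hα0.le hα1
  have h1 : Tendsto (fun t => Δ t ω (x, b)) atTop (𝓝 0) :=
    squeeze_zero_norm (fun t => norm_le_pi_norm (Δ t ω) (x, b)) hlim
  simpa [Δ, Q] using h1.add_const (Qs x b)

end Convergence

section TimeSeriesDuality

variable {E : Type*} {T : Finset E} {k : ℕ}

theorem integral_carryOver [MeasurableSpace T] [MeasurableSingletonClass T]
    (z : Fin k → T) (μ : ProbabilityMeasure T)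
    (φ : (Fin (k + 1) → T) → ℝ) :
    ∫ y, φ y ∂(carryOver z μ : Measure (Fin (k + 1) → T)) =
      ∫ w, φ (Fin.snoc z w) ∂(μ : Measure T) := by
  change ∫ y, φ y ∂(((Measure.dirac z).prod (μ : Measure T)).map
    (fun w : (Fin k → T) × T => (Fin.snoc w.1 w.2 : Fin (k + 1) → T))) = _
  rw [integral_map Measurable.of_discrete.aemeasurable
    Measurable.of_discrete.aestronglyMeasurable, Measure.dirac_prod,
    integral_map Measurable.of_discrete.aemeasurable
    Measurable.of_discrete.aestronglyMeasurable]

variable [NormedAddCommGroup E]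

theorem timeSeriesCost_self {q : ℕ} (hq : 1 ≤ q) (x : Fin (k + 1) → T) :
    timeSeriesCost q x x = 0 := by
  simp [timeSeriesCost, normCost_self hq]

theorem timeSeriesCost_snoc_snoc (q : ℕ) (z : Fin k → T) (w w' : T) :
    timeSeriesCost q (Fin.snoc z w : Fin (k + 1) → T) (Fin.snoc z w') = normCost q w w' := by
  simp [timeSeriesCost]

/-- Since points with different first components are infinitely far apart, the time-series transform
only acts on the last component. -/
theorem lambdaCTransform_timeSeriesCost_snoc (q : ℕ) (l : ℝ) (g : (Fin (k + 1) → T) → ℝ)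
    (z : Fin k → T) (w : T) :
    lambdaCTransform (timeSeriesCost q) l g (Fin.snoc z w) =
      lambdaCTransform (normCost q) l (fun w' => g (Fin.snoc z w')) w := by
  unfold lambdaCTransform
  symm
  refine Function.Surjective.iSup_congr
    (fun w' : {w' : T // normCost q w w' ≠ ∞} =>
      (⟨Fin.snoc z w'.1, by rw [timeSeriesCost_snoc_snoc]; exact w'.2⟩ :
        {y : Fin (k + 1) → T // timeSeriesCost q (Fin.snoc z w) y ≠ ∞})) ?_ ?_
  · rintro ⟨y, hy⟩
    have hz : z = Fin.init y := by
      by_contra hne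
      exact hy (by simp [timeSeriesCost, hne])
    refine ⟨⟨y (Fin.last k), normCost_ne_top _ _ _⟩, Subtype.ext ?_⟩
    simp [hz]
  · intro w'
    simp only [timeSeriesCost_snoc_snoc]

theorem infExp_timeSeriesBall [MeasurableSpace T] [MeasurableSingletonClass T]
    {q : ℕ} (hq : 1 ≤ q) {ε : ℝ} (hε : 0 < ε) (x : Fin (k + 1) → T)
    (ν : ProbabilityMeasure T) (f : (Fin (k + 1) → T) → ℝ) :
    infExp (timeSeriesBall q ε x ν) f =
      infExp (wassersteinBall q ε ν) (fun w => f (Fin.snoc (Fin.tail x) w)) := by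
  refine le_antisymm ?_ ?_
  · refine le_infExp ⟨ν, self_mem_wassersteinBall hq hε ν⟩ fun μ hμ => ?_
    rw [← integral_carryOver (Fin.tail x) μ f]
    exact infExp_le f ⟨μ, hμ, rfl⟩
  · have hne : (timeSeriesBall q ε x ν).Nonempty :=
      ⟨_, ν, self_mem_wassersteinBall hq hε ν, rfl⟩
    refine le_infExp hne ?_
    intro _ hP
    obtain ⟨μ, hμ, rfl⟩ := hP
    rw [integral_carryOver]
    exact infExp_le _ hμ

end TimeSeriesDuality

end RobustQ

theorem theorem3p2 (α : ℝ) (hα0 : 0 < α) (hα1 : α < 1) (q : ℕ) (hq : 1 ≤ q)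
    (ε : ℝ) (hε : 0 < ε) (m : ℕ) (A : Finset (EuclideanSpace ℝ (Fin m)))
    (γ : ℕ → ℝ) (hγ : ∀ n, γ n ∈ Set.Icc (0 : ℝ) 1) :
    -- Part (i): Wasserstein ball on a finite state space in `ℝ^d`
    (∀ (d : ℕ) (X : Finset (EuclideanSpace ℝ (Fin d))) (r : X → A → X → ℝ)
      (Phat : X → A → ProbabilityMeasure X) (x₀ : X) (a : ℕ → X → A) (Q₀ : X → A → ℝ)
      (lam : ℕ → (ℕ → X) → ℝ),
      RobustQ.StepSizeCondition (RobustQ.controlledMeasure Phat x₀ a) γ a →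
      RobustQ.IsMultiplierChoice α ε q r (RobustQ.normCost q) Phat γ a Q₀ lam →
      ∀ (x : X) (b : A),
        ∀ᵐ ω ∂(RobustQ.controlledMeasure Phat x₀ a : Measure (ℕ → X)),
          Tendsto
            (fun t => RobustQ.qIterate α ε q r (RobustQ.normCost q) γ a Q₀ lam t ω x b) atTop
            (𝓝 (RobustQ.optimalQ α r
              (fun y b' => RobustQ.wassersteinBall q ε (Phat y b')) x b))) ∧
    -- Part (ii): time-series ambiguity set on `T^h`, with `h = k + 1 ≥ 2`
    (∀ (D k : ℕ) (_ : 1 ≤ k) (T : Finset (EuclideanSpace ℝ (Fin D)))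
      (r : (Fin (k + 1) → T) → A → (Fin (k + 1) → T) → ℝ)
      (Ptilde : (Fin (k + 1) → T) → A → ProbabilityMeasure T)
      (Phat : (Fin (k + 1) → T) → A → ProbabilityMeasure (Fin (k + 1) → T))
      (_ : ∀ y b', Phat y b' = RobustQ.carryOver (Fin.tail y) (Ptilde y b'))
      (x₀ : Fin (k + 1) → T) (a : ℕ → (Fin (k + 1) → T) → A)
      (Q₀ : (Fin (k + 1) → T) → A → ℝ) (lam : ℕ → (ℕ → (Fin (k + 1) → T)) → ℝ),
      RobustQ.StepSizeCondition (RobustQ.controlledMeasure Phat x₀ a) γ a →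
      RobustQ.IsMultiplierChoice α ε q r (RobustQ.timeSeriesCost q) Phat γ a Q₀ lam →
      ∀ (x : Fin (k + 1) → T) (b : A),
        ∀ᵐ ω ∂(RobustQ.controlledMeasure Phat x₀ a : Measure (ℕ → (Fin (k + 1) → T))),
          Tendsto
            (fun t => RobustQ.qIterate α ε q r (RobustQ.timeSeriesCost q) γ a Q₀ lam t ω x b)
            atTop
            (𝓝 (RobustQ.optimalQ α r
              (fun y b' => RobustQ.timeSeriesBall q ε y (Ptilde y b')) x b))) := by
  refine ⟨?_, ?_⟩
  · intro d X r Phat x₀ a Q₀ lam hstep hlam x b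
    have : Nonempty A := ⟨b⟩
    exact RobustQ.ae_tendsto_qIterate hα0 hα1 hε hγ r (RobustQ.normCost_self hq)
      (fun x b => ⟨Phat x b, RobustQ.self_mem_wassersteinBall hq hε _⟩)
      (fun x b f l hl hmax => RobustQ.integral_lambdaCTransform_eq_infExp_wassersteinBall hq hε
        (Phat x b) f hl hmax) hstep hlam x b
  · intro D k _ T r Ptilde Phat hPhat x₀ a Q₀ lam hstep hlam x b
    have : Nonempty A := ⟨b⟩
    refine RobustQ.ae_tendsto_qIterate
      (P := fun y b' => RobustQ.timeSeriesBall q ε y (Ptilde y b')) hα0 hα1 hε hγ r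
      (RobustQ.timeSeriesCost_self hq)
      (fun x b => ⟨_, Ptilde x b, RobustQ.self_mem_wassersteinBall hq hε _, rfl⟩)
      (fun x b f l hl hmax => ?_) hstep hlam x b
    simp only [hPhat, RobustQ.integral_carryOver,
      RobustQ.lambdaCTransform_timeSeriesCost_snoc] at hmax ⊢
    rw [RobustQ.infExp_timeSeriesBall hq hε]
    exact RobustQ.integral_lambdaCTransform_eq_infExp_wassersteinBall hq hε (Ptilde x b)
      (fun w => f (Fin.snoc (Fin.tail x) w)) hl hmax
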